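/- Let $\phi$ be the standard normal density, $\gamma(u)=\frac{1}{\pi(1+u^2)}$ the standard Cauchy density and $g(x)=\int\phi(x-u)\gamma(u)\,du$. For $\theta\in\mathbb R^n$ let $P_\theta$ be the law of $X=(X_1,\dots,X_n)$ with independent $X_i\sim\mathcal N(\theta_i,1)$, and $E_\theta$ the corresponding expectation. For $\alpha\in(0,1]$, the posterior distribution for the spike-and-slab prior $\bigotimes_{i=1}^n\big((1-\alpha)\delta_0+\alpha\,\mathrm{Cauchy}(1)\big)$ is $$\Pi_\alpha[\,\cdot\mid X]=\bigotimes_{i=1}^n\Big((1-a_\alpha(X_i))\,\delta_0+a_\alpha(X_i)\,G_{X_i}\Big),\qquad a_\alpha(x)=\frac{\alpha g(x)}{(1-\alpha)\phi(x)+\alpha g(x)},$$ where $G_x$ has Lebesgue density $u\mapsto\phi(x-u)\gamma(u)/g(x)$. Let $t(\alpha)\ge 0$ be the threshold of the coordinatewise posterior median, that is, the number such that the posterior median of a coordinate with observation $x$ is $0$ if and only if $|x|\le t(\alpha)$; the function $t$ is a strictly decreasing bijection from $(0,1]$ onto $[0,\infty)$. Let $\alpha_n=t^{-1}(\sqrt{2\log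 n})$ and let $\hat\alpha$ be a maximiser over $[\alpha_n,1]$ of the log-marginal likelihood $$\alpha\mapsto\sum_{i=1}^n\log\big((1-\alpha)\phi(X_i)+\alpha g(X_i)\big).$$ For $A>0$ and $n\ge 3$ put $t_n=\sqrt{2\log n-5\log\log n}$ and define the modified estimator $$\hat\alpha_A=\begin{cases}\hat\alpha&\text{if }t(\hat\alpha)\le t_n,\\ t^{-1}\big(\sqrt{2(1+A)\log n}\big)&\text{if }t(\hat\alpha)>t_n.\end{cases}$$ Let $\ell_0[s]=\{\theta\in\mathbb R^n:\#\{i:\theta_i\ne 0\}\le s\}$ and $r_n=2s_n\log(n/s_n)$. Then for every fixed $A>0$ there exist $C>0$, $c_0>0$ and $N_0>0$ such that for all $n\ge N_0$ and all real $s_n$ with $1\le s_n\le c_0 n$, $$\sup_{\theta_0\in\ell_0[s_n]}E_{\theta_0}\int\|\theta-\theta_0\|^2\,d\Pi_{\hat\alpha_A}(\theta\mid X)\le C\,r_n .$$ -/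

import Mathlib

open MeasureTheory ProbabilityTheory
open scoped ENNReal

namespace SpikeSlab

noncomputable section

/-- The standard normal density. -/
def phi (x : ℝ) : ℝ := gaussianPDFReal 0 1 x

/-- The density of the slab, the standard Cauchy distribution. -/
def slab (u : ℝ) : ℝ := cauchyPDFReal 0 1 u

/-- The convolution of the normal density with the slab. -/
def g (x : ℝ) : ℝ := ∫ u, phi (x - u) * slab u

/-- The posterior weight of the slab, given an observation `x` and prior weight `α`. -/
def weight (α x : ℝ) : ℝ := α * g x / ((1 - α) * phi x + α * g x)

/-- The posterior law of a nonzero coefficient, with density `φ(x - u) γ(u) / g(x)`. -/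
def slabPosterior (x : ℝ) : Measure ℝ :=
  volume.withDensity fun u => ENNReal.ofReal (phi (x - u) * slab u / g x)

/-- The posterior law of one coefficient, given its observation `x`, for the prior
`(1 - α) δ₀ + α Cauchy(1)`. -/
def coordPosterior (α x : ℝ) : Measure ℝ :=
  ENNReal.ofReal (1 - weight α x) • Measure.dirac 0 +
    ENNReal.ofReal (weight α x) • slabPosterior x

/-- The posterior law of the vector `θ` given the observation `X`, for prior weight `α`. -/
def posterior {n : ℕ} (α : ℝ) (X : Fin n → ℝ) : Measure (Fin n → ℝ) :=
  Measure.pi fun i => coordPosterior α (X i)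

/-- The law `P_θ` of the data: independent `N(θ i, 1)` coordinates. -/
def dataLaw {n : ℕ} (θ : Fin n → ℝ) : Measure (Fin n → ℝ) :=
  Measure.pi fun i => gaussianReal (θ i) 1

/-- `m` is a median of the measure `μ`. -/
def IsMedian (μ : Measure ℝ) (m : ℝ) : Prop :=
  1 / 2 ≤ μ (Set.Iic m) ∧ 1 / 2 ≤ μ (Set.Ici m)

/-- The threshold `t(α)` of the posterior median, for `0 < α ≤ 1`: the largest `x ≥ 0` at which
the posterior median is zero. The posterior median at `x` is zero if and only if `|x| ≤ t(α)`. -/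
def threshold (α : ℝ) : ℝ := sSup {x : ℝ | 0 ≤ x ∧ IsMedian (coordPosterior α x) 0}

/-- The inverse of the threshold function, which is a decreasing bijection from `(0, 1]`
onto `[0, ∞)`. -/
def thresholdInv (u : ℝ) : ℝ := Function.invFunOn threshold (Set.Ioc 0 1) u

/-- The log-marginal likelihood of the weight. -/
def logLik {n : ℕ} (X : Fin n → ℝ) (α : ℝ) : ℝ :=
  ∑ i, Real.log ((1 - α) * phi (X i) + α * g (X i))

/-- The lower end point `α_n` of the range of the weight: `t(α_n) = √(2 log n)`. -/
def alphaMin (n : ℕ) : ℝ := thresholdInv (√(2 * Real.log n))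

/-- `a` is a marginal maximum likelihood estimate of the weight: it maximises the log-marginal
likelihood over `[α_n, 1]`. -/
def IsMMLE {n : ℕ} (X : Fin n → ℝ) (a : ℝ) : Prop :=
  a ∈ Set.Icc (alphaMin n) 1 ∧ IsMaxOn (logLik X) (Set.Icc (alphaMin n) 1) a

/-- The modification `α̂_A` of an estimate `a` of the weight: `a` itself if `t(a) ≤ t_n`, where
`t_n² = 2 log n - 5 log log n`, and `t⁻¹(√(2 (1 + A) log n))` otherwise. -/
def modify (A : ℝ) (n : ℕ) (a : ℝ) : ℝ :=
  open scoped Classical in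
  if threshold a ≤ √(2 * Real.log n - 5 * Real.log (Real.log n)) then a
  else thresholdInv (√(2 * (1 + A) * Real.log n))

/-- The vectors with at most `s` nonzero coordinates. -/
def sparse (n : ℕ) (s : ℝ) : Set (Fin n → ℝ) :=
  {θ | (({i | θ i ≠ 0} : Set (Fin n)).ncard : ℝ) ≤ s}

/-- The posterior second moment `∫ ‖θ - θ₀‖² dΠ_α(θ | X)` around `θ₀`. -/
def posteriorLoss {n : ℕ} (α : ℝ) (θ₀ X : Fin n → ℝ) : ℝ≥0∞ :=
  ∫⁻ θ, ENNReal.ofReal (∑ i, (θ i - θ₀ i) ^ 2) ∂(posterior α X)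

/-- The minimax rate `r_n = 2 s log (n / s)`. -/
def rate (n : ℕ) (s : ℝ) : ℝ := 2 * s * Real.log (n / s)

end

end SpikeSlab

/-! With w the posterior weight of the slab, each coordinate costs at most (1-w)θ² + w(2(X-θ)² + C),
because the slab posterior has bounded second moment about the observation
(`exists_posteriorLoss_le`). It remains to control shrunk signals and noise coordinates that receive
weight.

Signals need neither probability nor a lower bound on the estimate a. As φ is at most e^{-x²/4}
g/(1+x²) up to a constant, (1-w)x² ≤ 4 log(n/s) + 1152 (s/n) g/den
(`one_sub_weight_mul_sq_le_log_add`), and the likelihood equation gives ∑ g/den ≤ n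
(`sum_g_div_den_le`). At most s signals then cost O(s log(n/s)). If the modification replaces a,
either s ≥ √n and the equation for the small value a still serves
(`one_sub_weight_mul_sq_le_of_small`), or s ≤ √n and O(log n) per signal is within the rate.

For the noise put σ = max(s, log² n). By concavity, a exceeds `upperWeight n σ` only if the score
there is nonnegative. A Chernoff bound with exp(α·score/2) handles this event: for pure noise the
first-order term has mean zero, and the second-order term gains from the Cauchy tail of g
(`lintegral_exp_tilt_le`), while a signal costs a factor of at most e^{1/2}. The event contributes
O(1/n) per noise coordinate (`lintegral_bad_event_le`). Off the event, if s ≥ log² n, the weight is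
at most `upperWeight n s` or the modified one, with noise risk O(s log(n/s)/n) per coordinate. If s
< log² n, then `upperWeight_log_sq_lt` shows that the modification is in force, and its weight, at
most of order n^{-1-A} log n, costs O(1/n) per coordinate (`lintegral_modified_noise_le`). -/

namespace SpikeSlab

/-! ### Normal and Cauchy densities and their convolution -/

theorem phi_eq (x : ℝ) : phi x = (√(2 * Real.pi))⁻¹ * Real.exp (-x ^ 2 / 2) := by
  simp [phi, gaussianPDFReal]

theorem slab_eq (u : ℝ) : slab u = Real.pi⁻¹ * (1 + u ^ 2)⁻¹ := by
  simp [slab, cauchyPDFReal, add_comm]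

theorem phi_pos (x : ℝ) : 0 < phi x := gaussianPDFReal_pos _ _ _ one_ne_zero

theorem slab_pos (u : ℝ) : 0 < slab u := cauchyPDF_pos _ one_ne_zero _

theorem continuous_phi : Continuous phi := by
  simp only [funext phi_eq]
  fun_prop

theorem continuous_slab : Continuous slab := by
  simp only [funext slab_eq]
  refine continuous_const.mul (Continuous.inv₀ (by fun_prop) fun x => ?_)
  positivity

theorem integrable_phi : Integrable phi := integrable_gaussianPDFReal _ _

theorem integrable_slab : Integrable slab := integrable_cauchyPDFReal _

theorem integral_phi : ∫ x, phi x = 1 := integral_gaussianPDFReal_eq_one _ one_ne_zero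

theorem integral_slab : ∫ x, slab x = 1 := integral_cauchyPDFReal_eq_one _ one_ne_zero

theorem phi_neg (x : ℝ) : phi (-x) = phi x := by simp [phi_eq]

theorem slab_neg (x : ℝ) : slab (-x) = slab x := by simp [slab_eq]

theorem two_le_sqrt_two_pi : 2 ≤ √(2 * Real.pi) := by
  apply Real.le_sqrt_of_sq_le
  nlinarith [Real.pi_gt_three]

theorem sqrt_two_pi_le_three : √(2 * Real.pi) ≤ 3 := by
  apply Real.sqrt_le_iff.2 ⟨by norm_num, ?_⟩
  nlinarith [Real.pi_le_four]

theorem phi_le (x : ℝ) : phi x ≤ 1 / 2 * Real.exp (-x ^ 2 / 2) := by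
  rw [phi_eq]
  gcongr
  rw [one_div]
  exact inv_anti₀ (by norm_num) two_le_sqrt_two_pi

theorem le_phi (x : ℝ) : 1 / 3 * Real.exp (-x ^ 2 / 2) ≤ phi x := by
  rw [phi_eq]
  gcongr
  rw [one_div]
  exact inv_anti₀ (by positivity) sqrt_two_pi_le_three

theorem phi_le_half (x : ℝ) : phi x ≤ 1 / 2 := by
  refine (phi_le x).trans ?_
  have : Real.exp (-x ^ 2 / 2) ≤ 1 := Real.exp_le_one_iff.2 (by nlinarith [sq_nonneg x])
  linarith

theorem one_sixth_le_phi {x : ℝ} (hx : x ^ 2 ≤ 1) : 1 / 6 ≤ phi x := by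
  refine le_trans ?_ (le_phi x)
  have := Real.add_one_le_exp (-x ^ 2 / 2)
  linarith

theorem inv_pi_le : Real.pi⁻¹ ≤ 1 / 3 := by
  rw [one_div]
  exact inv_anti₀ (by norm_num) Real.pi_gt_three.le

theorem le_inv_pi : 1 / 4 ≤ Real.pi⁻¹ := by
  rw [one_div]
  exact inv_anti₀ Real.pi_pos Real.pi_le_four

/-- Peetre's inequality for the Cauchy density. -/
theorem slab_mul_le (x u : ℝ) : (1 + x ^ 2) * slab u ≤ 2 / 3 * (1 + (x - u) ^ 2) := by
  rw [slab_eq]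
  have h0 : (0 : ℝ) < 1 + u ^ 2 := by positivity
  have h1 : (1 + x ^ 2) * (1 + u ^ 2)⁻¹ ≤ 2 * (1 + (x - u) ^ 2) := by
    rw [mul_inv_le_iff₀ h0]
    nlinarith [sq_nonneg (x - 2 * u), sq_nonneg ((x - u) * u)]
  have h2 : 0 ≤ (1 + x ^ 2) * (1 + u ^ 2)⁻¹ := by positivity
  nlinarith [inv_pi_le, le_inv_pi, sq_nonneg (x - u)]

theorem le_slab_of_near {x u : ℝ} (h : (u - x) ^ 2 ≤ 1) : 1 / 12 / (1 + x ^ 2) ≤ slab u := by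
  have h1 : 1 + u ^ 2 ≤ 3 * (1 + x ^ 2) := by nlinarith [sq_nonneg (u - 2 * x)]
  rw [slab_eq]
  have : (3 * (1 + x ^ 2))⁻¹ ≤ (1 + u ^ 2)⁻¹ := inv_anti₀ (by positivity) h1
  calc 1 / 12 / (1 + x ^ 2) = 1 / 4 * (3 * (1 + x ^ 2))⁻¹ := by field_simp; norm_num
    _ ≤ _ := by gcongr; exact le_inv_pi

theorem integrable_sq_mul_phi : Integrable fun v => v ^ 2 * phi v := by
  have := (integrable_rpow_mul_exp_neg_mul_sq (b := 1 / 2) (by norm_num) (s := 2) (by norm_num))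
  refine (this.const_mul (√(2 * Real.pi))⁻¹).congr (Filter.Eventually.of_forall fun x => ?_)
  simp only [phi_eq, Real.rpow_two]
  ring_nf

theorem integrable_pow_four_mul_phi : Integrable fun v => v ^ 4 * phi v := by
  have := (integrable_rpow_mul_exp_neg_mul_sq (b := 1 / 2) (by norm_num) (s := 4) (by norm_num))
  refine (this.const_mul (√(2 * Real.pi))⁻¹).congr (Filter.Eventually.of_forall fun x => ?_)
  have h : x ^ (4 : ℝ) = x ^ (4 : ℕ) := by exact_mod_cast Real.rpow_natCast x 4
  simp only [phi_eq, h]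
  ring_nf

theorem integral_sq_mul_phi : ∫ v, v ^ 2 * phi v = 1 := by
  have h := variance_id_gaussianReal (μ := 0) (v := 1)
  rw [variance_eq_integral (by fun_prop)] at h
  simp only [id, integral_id_gaussianReal, sub_zero] at h
  rw [integral_gaussianReal_eq_integral_smul one_ne_zero] at h
  simpa [phi, mul_comm] using h

theorem integrable_conv (x : ℝ) : Integrable fun u => phi (x - u) * slab u := by
  refine integrable_slab.bdd_mul (c := 1 / 2) ?_ ?_
  · exact (continuous_phi.comp (by fun_prop)).aestronglyMeasurable
  · refine Filter.Eventually.of_forall fun u => ?_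
    rw [Real.norm_of_nonneg (phi_pos _).le]
    exact phi_le_half _

theorem g_eq_comp (x : ℝ) : g x = ∫ v, phi v * slab (x - v) := by
  rw [g, ← integral_sub_left_eq_self (fun v => phi v * slab (x - v)) volume x]
  simp

/-- Peetre's inequality integrated against φ(x - u), whose mass and second moment are 1. With `le_g`
this shows that g keeps the Cauchy tail. -/
theorem g_le (x : ℝ) : g x ≤ 2 / (1 + x ^ 2) := by
  rw [le_div_iff₀ (by positivity), mul_comm, g, ← integral_const_mul]
  have hi : Integrable fun u => 2 / 3 * (phi u + u ^ 2 * phi u) :=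
    (integrable_phi.add integrable_sq_mul_phi).const_mul _
  calc ∫ u, (1 + x ^ 2) * (phi (x - u) * slab u)
      ≤ ∫ u, 2 / 3 * (phi (x - u) + (x - u) ^ 2 * phi (x - u)) := by
        refine integral_mono ((integrable_conv x).const_mul _) (hi.comp_sub_left x) fun u => ?_
        have := mul_le_mul_of_nonneg_left (slab_mul_le x u) (phi_pos (x - u)).le
        simp only
        nlinarith
    _ = ∫ u, 2 / 3 * (phi u + u ^ 2 * phi u) :=
        integral_sub_left_eq_self (fun u => 2 / 3 * (phi u + u ^ 2 * phi u)) volume x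
    _ ≤ 2 := by
        rw [integral_const_mul, integral_add integrable_phi integrable_sq_mul_phi,
          integral_phi, integral_sq_mul_phi]
        norm_num

/-- The second moment of the slab posterior about the observation, before normalisation. -/
theorem exists_slab_moment_le : ∃ C : ℝ, 0 < C ∧ ∀ x : ℝ,
    Integrable (fun u => (u - x) ^ 2 * (phi (x - u) * slab u)) ∧
      ∫ u, (u - x) ^ 2 * (phi (x - u) * slab u) ≤ C / (1 + x ^ 2) := by
  have hi : Integrable fun u : ℝ => u ^ 2 * phi u + u ^ 4 * phi u :=
    integrable_sq_mul_phi.add integrable_pow_four_mul_phi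
  refine ⟨(∫ u : ℝ, (u ^ 2 * phi u + u ^ 4 * phi u)) + 1, ?_, fun x => ?_⟩
  · have : 0 ≤ ∫ u : ℝ, (u ^ 2 * phi u + u ^ 4 * phi u) :=
      integral_nonneg fun u => by have := phi_pos u; positivity
    linarith
  have hb : ∀ u, (1 + x ^ 2) * ((u - x) ^ 2 * (phi (x - u) * slab u)) ≤
      (x - u) ^ 2 * phi (x - u) + (x - u) ^ 4 * phi (x - u) := fun u => by
    have h1 := phi_pos (x - u)
    have h2 : 0 ≤ (x - u) ^ 2 * phi (x - u) := by positivity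
    have := mul_le_mul_of_nonneg_left (slab_mul_le x u) h2
    nlinarith [mul_nonneg h2 (sq_nonneg (x - u))]
  have hint : Integrable fun u => (1 + x ^ 2) * ((u - x) ^ 2 * (phi (x - u) * slab u)) := by
    refine (hi.comp_sub_left x).mono' ?_ (Filter.Eventually.of_forall fun u => ?_)
    · have h1 : Continuous fun u => phi (x - u) := continuous_phi.comp (by fun_prop)
      have h2 := continuous_slab
      exact Continuous.aestronglyMeasurable (by fun_prop)
    · rw [Real.norm_of_nonneg]
      · exact hb u
      · have := phi_pos (x - u)
        have := slab_pos u
        positivity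
  constructor
  · refine (hint.const_mul (1 + x ^ 2)⁻¹).congr (Filter.Eventually.of_forall fun u => ?_)
    simp only
    have : (1 + x ^ 2) ≠ 0 := by positivity
    field_simp
  · rw [le_div_iff₀ (by positivity), mul_comm, ← integral_const_mul]
    calc _ ≤ ∫ u, ((x - u) ^ 2 * phi (x - u) + (x - u) ^ 4 * phi (x - u)) :=
          integral_mono hint (hi.comp_sub_left x) hb
      _ = ∫ u : ℝ, (u ^ 2 * phi u + u ^ 4 * phi u) :=
          integral_sub_left_eq_self (fun u : ℝ => u ^ 2 * phi u + u ^ 4 * phi u) volume x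
      _ ≤ _ := by linarith

/-- Only |u - x| ≤ 1 is kept in the convolution: 2 · 1/6 · 1/12 = 1/36. -/
theorem le_g (x : ℝ) : 1 / 36 / (1 + x ^ 2) ≤ g x := by
  have h0 : ∀ u, 0 ≤ phi (x - u) * slab u := fun u =>
    mul_nonneg (phi_pos _).le (slab_pos _).le
  calc 1 / 36 / (1 + x ^ 2)
      = ∫ u in Set.Icc (x - 1) (x + 1), 1 / 6 * (1 / 12 / (1 + x ^ 2)) := by
        rw [setIntegral_const]
        simp only [measureReal_def, Real.volume_Icc, smul_eq_mul]
        rw [ENNReal.toReal_ofReal (by linarith)]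
        ring
    _ ≤ ∫ u in Set.Icc (x - 1) (x + 1), phi (x - u) * slab u := by
        refine setIntegral_mono_on (integrableOn_const (by simp)) (integrable_conv x).integrableOn
          measurableSet_Icc fun u hu => ?_
        have h1 : (u - x) ^ 2 ≤ 1 := by nlinarith [hu.1, hu.2]
        have h2 : (x - u) ^ 2 ≤ 1 := by nlinarith
        exact mul_le_mul (one_sixth_le_phi h2) (le_slab_of_near h1) (by positivity) (phi_pos _).le
    _ ≤ g x := setIntegral_le_integral (integrable_conv x) (Filter.Eventually.of_forall h0)

theorem g_pos (x : ℝ) : 0 < g x := lt_of_lt_of_le (by positivity) (le_g x)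

theorem continuous_g : Continuous g := by
  refine continuous_of_dominated (bound := slab) (fun x => (integrable_conv x).1)
    (fun x => Filter.Eventually.of_forall fun u => ?_) integrable_slab
    (Filter.Eventually.of_forall fun u => ?_)
  · rw [Real.norm_of_nonneg (mul_nonneg (phi_pos _).le (slab_pos _).le)]
    nlinarith [phi_le_half (x - u), slab_pos u]
  · exact (continuous_phi.comp (by fun_prop)).mul continuous_const

theorem integrable_g_and_integral_g : Integrable g ∧ ∫ x, g x = 1 := by
  have h := (integrable_phi.convolution_integrand (ContinuousLinearMap.mul ℝ ℝ)
    integrable_slab)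
  have e : ∀ x, g x = ∫ t, (ContinuousLinearMap.mul ℝ ℝ) (phi t) (slab (x - t)) := fun x => by
    simp [g_eq_comp]
  have e' : g = convolution phi slab (ContinuousLinearMap.mul ℝ ℝ) volume := by
    ext x; rw [e]; rfl
  refine ⟨?_, ?_⟩
  · rw [e']
    exact integrable_phi.integrable_convolution _ integrable_slab
  · rw [e', integral_convolution _ integrable_phi integrable_slab]
    simp [integral_phi, integral_slab]

theorem integrable_g : Integrable g := integrable_g_and_integral_g.1

theorem integral_g : ∫ x, g x = 1 := integrable_g_and_integral_g.2

theorem one_add_sq_le_exp {y : ℝ} (hy : 0 ≤ y) : (1 + y) ^ 2 ≤ 64 * Real.exp (y / 4) := by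
  have h := Real.add_one_le_exp (y / 8)
  have e : Real.exp (y / 4) = Real.exp (y / 8) ^ 2 := by rw [← Real.exp_nat_mul]; ring_nf
  have : (1 + y) / 8 ≤ Real.exp (y / 8) := by linarith
  rw [e]
  nlinarith [pow_le_pow_left₀ (by positivity) this 2]

/-- The ratio of the normal density and the slab marginal has Gaussian decay. -/
theorem phi_le_mul_g (x : ℝ) :
    (1 + x ^ 2) * phi x ≤ 1152 * Real.exp (-x ^ 2 / 4) * g x := by
  have h1 := phi_le x
  have h2 := le_g x
  rw [div_le_iff₀ (by positivity)] at h2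
  have h3 := one_add_sq_le_exp (sq_nonneg x)
  have e : Real.exp (-x ^ 2 / 2) = Real.exp (-x ^ 2 / 4) * Real.exp (-x ^ 2 / 4) := by
    rw [← Real.exp_add]; ring_nf
  have e' : Real.exp (-x ^ 2 / 4) * Real.exp (x ^ 2 / 4) = 1 := by
    rw [← Real.exp_add]; simp [neg_div]
  have hp := Real.exp_pos (-x ^ 2 / 4)
  set E := Real.exp (-x ^ 2 / 4)
  have h4 : E * (1 + x ^ 2) ^ 2 ≤ 64 := by
    calc _ ≤ E * (64 * Real.exp (x ^ 2 / 4)) := by gcongr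
      _ = 64 * (E * Real.exp (x ^ 2 / 4)) := by ring
      _ = 64 := by rw [e', mul_one]
  have hg := g_pos x
  calc (1 + x ^ 2) * phi x ≤ (1 + x ^ 2) * (1 / 2 * (E * E)) := by rw [← e]; gcongr
    _ = 18 * E * (E * (1 + x ^ 2)) * (1 / 36) := by ring
    _ ≤ 18 * E * (E * (1 + x ^ 2)) * (g x * (1 + x ^ 2)) := by gcongr
    _ = 18 * E * (E * (1 + x ^ 2) ^ 2) * g x := by ring
    _ ≤ 18 * E * 64 * g x := by gcongr
    _ = _ := by ring

theorem phi_le_exp_mul_g (x : ℝ) : phi x ≤ 1152 * Real.exp (-x ^ 2 / 4) * g x := by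
  refine le_trans ?_ (phi_le_mul_g x)
  nlinarith [phi_pos x, sq_nonneg x]

/-! ### Odds at which the posterior median leaves zero -/

/-- The part of the slab marginal that comes from positive coefficients. -/
noncomputable def gPos (x : ℝ) : ℝ := ∫ u in Set.Ioi 0, phi (x - u) * slab u

/-- The value of `(1 - α) / α` at which `x` is the threshold of the posterior median. -/
noncomputable def odds (x : ℝ) : ℝ := (gPos x - gPos (-x)) / phi x

theorem setIntegral_Iic_conv (x : ℝ) :
    ∫ u in Set.Iic 0, phi (x - u) * slab u = gPos (-x) := by
  have := integral_comp_neg_Iic 0 (fun u => phi (-x - u) * slab u)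
  rw [neg_zero] at this
  rw [gPos, ← this]
  refine integral_congr_ae (Filter.Eventually.of_forall fun u => ?_)
  simp only [slab_neg]
  rw [← phi_neg]
  ring_nf

theorem gPos_add_gPos_neg (x : ℝ) : gPos x + gPos (-x) = g x := by
  rw [← setIntegral_Iic_conv, gPos, g, add_comm]
  have := intervalIntegral.integral_Iic_add_Ioi (b := (0 : ℝ)) (integrable_conv x).integrableOn
    (integrable_conv x).integrableOn
  exact this

theorem setIntegral_Ici_conv (x : ℝ) :
    ∫ u in Set.Ici 0, phi (x - u) * slab u = gPos x := integral_Ici_eq_integral_Ioi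

theorem gPos_nonneg (x : ℝ) : 0 ≤ gPos x :=
  setIntegral_nonneg measurableSet_Ioi fun _ _ => mul_nonneg (phi_pos _).le (slab_pos _).le

theorem continuous_gPos : Continuous gPos := by
  refine continuous_of_dominated (bound := slab) (fun x => (integrable_conv x).1.restrict)
    (fun x => Filter.Eventually.of_forall fun u => ?_) integrable_slab.restrict
    (Filter.Eventually.of_forall fun u => ?_)
  · rw [Real.norm_of_nonneg (mul_nonneg (phi_pos _).le (slab_pos _).le)]
    nlinarith [phi_le_half (x - u), slab_pos u]
  · exact (continuous_phi.comp (by fun_prop)).mul continuous_const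

theorem continuous_odds : Continuous odds :=
  (continuous_gPos.sub (continuous_gPos.comp continuous_neg)).div continuous_phi
    fun x => (phi_pos x).ne'

theorem phi_sub_div (x u : ℝ) :
    phi (x - u) / phi x = Real.exp (x * u) * Real.exp (-u ^ 2 / 2) := by
  rw [phi_eq, phi_eq, mul_div_mul_left _ _ (by positivity), ← Real.exp_sub, ← Real.exp_add]
  ring_nf

/-- Since φ(x - u)/φ(x) = e^{xu} e^{-u²/2}, the odds integrate 2 sinh(xu) against a positive weight;
this makes them increasing in x ≥ 0. -/
theorem odds_eq_integral (x : ℝ) :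
    IntegrableOn (fun u => (Real.exp (x * u) - Real.exp (-x * u)) *
        (Real.exp (-u ^ 2 / 2) * slab u)) (Set.Ioi 0) ∧
      odds x = ∫ u in Set.Ioi 0, (Real.exp (x * u) - Real.exp (-x * u)) *
        (Real.exp (-u ^ 2 / 2) * slab u) := by
  have e : ∀ u, (Real.exp (x * u) - Real.exp (-x * u)) * (Real.exp (-u ^ 2 / 2) * slab u) =
      (phi (x - u) * slab u - phi (-x - u) * slab u) / phi x := fun u => by
    have h1 := phi_sub_div x u
    have h2 := phi_sub_div (-x) u
    rw [phi_neg] at h2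
    have := (phi_pos x).ne'
    calc _ = (Real.exp (x * u) * Real.exp (-u ^ 2 / 2)
          - Real.exp (-x * u) * Real.exp (-u ^ 2 / 2)) * slab u := by ring
      _ = _ := by rw [← h1, ← h2]; ring
  have h1 := (integrable_conv x).integrableOn (s := Set.Ioi 0)
  have h2 := (integrable_conv (-x)).integrableOn (s := Set.Ioi 0)
  simp only [e]
  refine ⟨(h1.sub h2).div_const _, ?_⟩
  rw [integral_div, integral_sub h1 h2]
  rfl

theorem odds_strictMonoOn : StrictMonoOn odds (Set.Ici 0) := by
  intro x hx y hy hxy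
  obtain ⟨hi, e⟩ := odds_eq_integral x
  obtain ⟨hi', e'⟩ := odds_eq_integral y
  have hlt : ∀ u ∈ Set.Ioi (0 : ℝ),
      0 < (Real.exp (y * u) - Real.exp (-y * u)) * (Real.exp (-u ^ 2 / 2) * slab u) -
      (Real.exp (x * u) - Real.exp (-x * u)) * (Real.exp (-u ^ 2 / 2) * slab u) := by
    intro u hu
    have hu : 0 < u := hu
    have h1 : Real.exp (x * u) < Real.exp (y * u) := Real.exp_lt_exp.2 (by nlinarith)
    have h2 : Real.exp (-y * u) < Real.exp (-x * u) := Real.exp_lt_exp.2 (by nlinarith)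
    have h3 : 0 < Real.exp (-u ^ 2 / 2) * slab u := mul_pos (Real.exp_pos _) (slab_pos u)
    rw [← sub_mul]
    exact mul_pos (by linarith) h3
  rw [← sub_pos, e, e', ← integral_sub hi' hi]
  refine (setIntegral_pos_iff_support_of_nonneg_ae ?_ (hi'.sub hi)).2 ?_
  · filter_upwards [ae_restrict_mem measurableSet_Ioi] with u hu
    exact (hlt u hu).le
  · refine lt_of_lt_of_le ?_ (measure_mono (s := Set.Ioi 0) fun u hu => ⟨(hlt u hu).ne', hu⟩)
    simp

theorem odds_zero : odds 0 = 0 := by simp [odds]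

theorem odds_nonneg {x : ℝ} (hx : 0 ≤ x) : 0 ≤ odds x :=
  odds_zero ▸ odds_strictMonoOn.monotoneOn (Set.mem_Ici.2 le_rfl) hx hx

theorem inv_phi_le (x : ℝ) : (phi x)⁻¹ ≤ 3 * Real.exp (x ^ 2 / 2) := by
  have h := le_phi x
  rw [neg_div, Real.exp_neg] at h
  rw [inv_le_comm₀ (phi_pos x) (by positivity), mul_inv]
  linarith

theorem le_inv_phi (x : ℝ) : 2 * Real.exp (x ^ 2 / 2) ≤ (phi x)⁻¹ := by
  have h := phi_le x
  rw [neg_div, Real.exp_neg] at h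
  rw [le_inv_comm₀ (by positivity) (phi_pos x), mul_inv]
  linarith

theorem odds_le (x : ℝ) : odds x ≤ 6 * Real.exp (x ^ 2 / 2) / (1 + x ^ 2) := by
  have h1 : gPos x - gPos (-x) ≤ g x := by
    linarith [gPos_add_gPos_neg x, gPos_nonneg (-x)]
  rw [odds, div_eq_mul_inv]
  have hp := inv_pos.2 (phi_pos x)
  calc _ ≤ (2 / (1 + x ^ 2)) * (phi x)⁻¹ := by gcongr; exact h1.trans (g_le x)
    _ ≤ (2 / (1 + x ^ 2)) * (3 * Real.exp (x ^ 2 / 2)) := by gcongr; exact inv_phi_le x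
    _ = _ := by ring

/-- Only u in [x, x + 1] is kept. There e^{2xu} ≥ 3, so the reflected density removes at most a
third of φ(x - u). -/
theorem le_odds {x : ℝ} (hx : 1 ≤ x) : Real.exp (x ^ 2 / 2) / (54 * (1 + x ^ 2)) ≤ odds x := by
  have h1 := (integrable_conv x).integrableOn (s := Set.Ioi 0)
  have h2 := (integrable_conv (-x)).integrableOn (s := Set.Ioi 0)
  have key : ∀ u, 0 < u → phi (-x - u) ≤ 1 / 3 * phi (x - u) ∨ u < x := by
    intro u hu
    by_cases h : u < x
    · exact Or.inr h
    left
    push Not at h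
    rw [phi_eq, phi_eq, ← mul_assoc, mul_comm (1 / 3 : ℝ), mul_assoc]
    gcongr
    have e : Real.exp (-(x - u) ^ 2 / 2) =
        Real.exp (-(-x - u) ^ 2 / 2) * Real.exp (2 * x * u) := by
      rw [← Real.exp_add]; ring_nf
    have : 3 ≤ Real.exp (2 * x * u) := by
      have := Real.add_one_le_exp (2 * x * u)
      nlinarith
    rw [e]
    nlinarith [Real.exp_pos (-(-x - u) ^ 2 / 2)]
  have hnn : ∀ u ∈ Set.Ioi (0 : ℝ), 0 ≤ phi (x - u) * slab u - phi (-x - u) * slab u := by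
    intro u hu
    rw [← sub_mul]
    refine mul_nonneg (sub_nonneg.2 ?_) (slab_pos u).le
    rw [phi_eq, phi_eq]
    have hu : 0 < u := hu
    gcongr ?_ * Real.exp ?_
    nlinarith
  have hgap : 1 / 108 / (1 + x ^ 2) ≤ gPos x - gPos (-x) := by
    rw [gPos, gPos, ← integral_sub h1 h2]
    calc 1 / 108 / (1 + x ^ 2)
        = ∫ u in Set.Icc x (x + 1), 1 / 9 * (1 / 12 / (1 + x ^ 2)) := by
          rw [setIntegral_const]
          simp only [measureReal_def, Real.volume_Icc, smul_eq_mul]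
          rw [ENNReal.toReal_ofReal (by linarith)]
          ring
      _ ≤ ∫ u in Set.Icc x (x + 1), (phi (x - u) * slab u - phi (-x - u) * slab u) := by
          refine setIntegral_mono_on (integrableOn_const (by simp))
            ((integrable_conv x).sub (integrable_conv (-x))).integrableOn
            measurableSet_Icc fun u hu => ?_
          have h1 : (u - x) ^ 2 ≤ 1 := by nlinarith [hu.1, hu.2]
          have h2 : (x - u) ^ 2 ≤ 1 := by nlinarith
          have h3 := (key u (by linarith [hu.1])).resolve_right (not_lt.2 hu.1)
          have h4 := one_sixth_le_phi h2
          rw [← sub_mul]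
          exact mul_le_mul (by linarith) (le_slab_of_near h1) (by positivity) (by linarith)
      _ ≤ _ := by
          refine setIntegral_mono_set (h1.sub h2) ?_ ?_
          · filter_upwards [ae_restrict_mem measurableSet_Ioi] with u hu
            exact hnn u hu
          · exact Filter.Eventually.of_forall fun u hu => lt_of_lt_of_le (by linarith) hu.1
  rw [odds, div_eq_mul_inv (gPos x - _)]
  calc Real.exp (x ^ 2 / 2) / (54 * (1 + x ^ 2))
      = 1 / 108 / (1 + x ^ 2) * (2 * Real.exp (x ^ 2 / 2)) := by field_simp; norm_num
    _ ≤ _ := mul_le_mul hgap (le_inv_phi x) (by positivity) (le_trans (by positivity) hgap)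

/-! ### Posterior of one coordinate and the threshold of its median -/

theorem den_pos {α : ℝ} (h0 : 0 < α) (h1 : α ≤ 1) (x : ℝ) :
    0 < (1 - α) * phi x + α * g x := by
  have := phi_pos x
  have := g_pos x
  have : 0 ≤ (1 - α) * phi x := mul_nonneg (by linarith) (phi_pos x).le
  positivity

theorem weight_nonneg {α : ℝ} (h0 : 0 < α) (h1 : α ≤ 1) (x : ℝ) : 0 ≤ weight α x :=
  div_nonneg (mul_pos h0 (g_pos x)).le (den_pos h0 h1 x).le

theorem one_sub_weight {α : ℝ} (h0 : 0 < α) (h1 : α ≤ 1) (x : ℝ) :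
    1 - weight α x = (1 - α) * phi x / ((1 - α) * phi x + α * g x) := by
  rw [weight, eq_div_iff (den_pos h0 h1 x).ne', sub_mul, div_mul_cancel₀ _ (den_pos h0 h1 x).ne']
  ring

theorem weight_le_one {α : ℝ} (h0 : 0 < α) (h1 : α ≤ 1) (x : ℝ) : weight α x ≤ 1 := by
  rw [← sub_nonneg, one_sub_weight h0 h1]
  exact div_nonneg (mul_nonneg (by linarith) (phi_pos x).le) (den_pos h0 h1 x).le

theorem slabPosterior_apply (x : ℝ) {s : Set ℝ} (hs : MeasurableSet s) :
    slabPosterior x s = ENNReal.ofReal ((∫ u in s, phi (x - u) * slab u) / g x) := by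
  rw [slabPosterior, withDensity_apply _ hs, ← integral_div,
    ofReal_integral_eq_lintegral_ofReal ((integrable_conv x).integrableOn.div_const _)]
  exact Filter.Eventually.of_forall fun u =>
    div_nonneg (mul_nonneg (phi_pos _).le (slab_pos _).le) (g_pos x).le

instance isProbabilityMeasure_slabPosterior (x : ℝ) : IsProbabilityMeasure (slabPosterior x) := by
  refine ⟨?_⟩
  rw [slabPosterior_apply x MeasurableSet.univ, setIntegral_univ]
  change ENNReal.ofReal (g x / g x) = 1
  rw [div_self (g_pos x).ne', ENNReal.ofReal_one]

theorem isProbabilityMeasure_coordPosterior {α : ℝ} (h0 : 0 < α) (h1 : α ≤ 1) (x : ℝ) :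
    IsProbabilityMeasure (coordPosterior α x) := by
  refine ⟨?_⟩
  have := weight_nonneg h0 h1 x
  have := weight_le_one h0 h1 x
  simp only [coordPosterior, Measure.add_apply, Measure.smul_apply, measure_univ, smul_eq_mul,
    mul_one]
  rw [← ENNReal.ofReal_add (by linarith) (by linarith)]
  simp

theorem half_le_coordPosterior_iff {α : ℝ} (h0 : 0 < α) (h1 : α ≤ 1) (x : ℝ) {s : Set ℝ}
    (hs : MeasurableSet s) (hs0 : (0 : ℝ) ∈ s) :
    1 / 2 ≤ coordPosterior α x s ↔
      α * (g x - 2 * ∫ u in s, phi (x - u) * slab u) ≤ (1 - α) * phi x := by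
  have hw := weight_nonneg h0 h1 x
  have hw' := weight_le_one h0 h1 x
  have hg := g_pos x
  have hI : 0 ≤ ∫ u in s, phi (x - u) * slab u :=
    setIntegral_nonneg hs fun u _ => mul_nonneg (phi_pos _).le (slab_pos _).le
  have hd := den_pos h0 h1 x
  set I := ∫ u in s, phi (x - u) * slab u
  have e : coordPosterior α x s =
      ENNReal.ofReal (((1 - α) * phi x + α * I) / ((1 - α) * phi x + α * g x)) := by
    simp only [coordPosterior, Measure.add_apply, Measure.smul_apply, smul_eq_mul,
      Measure.dirac_apply' _ hs, Set.indicator_of_mem hs0, Pi.one_apply, mul_one,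
      slabPosterior_apply x hs]
    rw [← ENNReal.ofReal_mul hw, ← ENNReal.ofReal_add (by linarith) (by positivity),
      one_sub_weight h0 h1, weight]
    congr 1
    change _ + _ * (I / g x) = _
    field_simp
  have e2 : (1 / 2 : ℝ≥0∞) = ENNReal.ofReal (1 / 2) := by
    rw [ENNReal.ofReal_div_of_pos (by norm_num)]; simp
  rw [e, e2, ENNReal.ofReal_le_ofReal_iff', or_iff_left (by norm_num), le_div_iff₀ hd]
  constructor <;> intro h <;> linarith

/-- For x ≥ 0 the slab posterior favours the positive half-line, so only the condition on `Iic` can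
fail. -/
theorem isMedian_zero_iff {α : ℝ} (h0 : 0 < α) (h1 : α ≤ 1) {x : ℝ} (hx : 0 ≤ x) :
    IsMedian (coordPosterior α x) 0 ↔ α * odds x ≤ 1 - α := by
  have hφ := phi_pos x
  have hodds := odds_nonneg hx
  have e : gPos x - gPos (-x) = odds x * phi x := by rw [odds, div_mul_cancel₀ _ hφ.ne']
  rw [IsMedian, half_le_coordPosterior_iff h0 h1 x measurableSet_Iic (by simp),
    half_le_coordPosterior_iff h0 h1 x measurableSet_Ici (by simp), setIntegral_Iic_conv,
    setIntegral_Ici_conv, ← gPos_add_gPos_neg,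
    show gPos x + gPos (-x) - 2 * gPos (-x) = odds x * phi x by linarith,
    show gPos x + gPos (-x) - 2 * gPos x = -(odds x * phi x) by linarith,
    ← mul_assoc, mul_le_mul_iff_left₀ hφ]
  refine and_iff_left_of_imp fun _ => ?_
  have : 0 ≤ α * (odds x * phi x) := by positivity
  have : 0 ≤ (1 - α) * phi x := mul_nonneg (by linarith) hφ.le
  linarith

/-- The weight whose threshold is `t`. -/
noncomputable def weightOf (t : ℝ) : ℝ := 1 / (1 + odds t)

theorem weightOf_mem {t : ℝ} (ht : 0 ≤ t) : weightOf t ∈ Set.Ioc 0 1 := by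
  have := odds_nonneg ht
  refine ⟨by unfold weightOf; positivity, ?_⟩
  rw [weightOf, div_le_one (by positivity)]
  linarith

theorem weightOf_strictAntiOn : StrictAntiOn weightOf (Set.Ici 0) := by
  intro s hs t ht hst
  have := odds_strictMonoOn hs ht hst
  have := odds_nonneg (Set.mem_Ici.1 hs)
  unfold weightOf
  gcongr

theorem threshold_weightOf {t : ℝ} (ht : 0 ≤ t) : threshold (weightOf t) = t := by
  obtain ⟨h0, h1⟩ := weightOf_mem ht
  have : {x : ℝ | 0 ≤ x ∧ IsMedian (coordPosterior (weightOf t) x) 0} = Set.Icc 0 t := by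
    ext x
    refine and_congr_right fun hx => ?_
    rw [isMedian_zero_iff h0 h1 hx, ← odds_strictMonoOn.le_iff_le hx ht]
    have := odds_nonneg ht
    have h2 : 1 - weightOf t = weightOf t * odds t := by
      unfold weightOf; field_simp; ring
    rw [h2]
    exact mul_le_mul_iff_right₀ h0
  rw [threshold, this, csSup_Icc ht]

theorem exists_eq_weightOf {α : ℝ} (h0 : 0 < α) (h1 : α ≤ 1) : ∃ t, 0 ≤ t ∧ weightOf t = α := by
  set y := 1 / α - 1
  have hy : 0 ≤ y := by
    have : 1 ≤ 1 / α := by rw [le_div_iff₀ h0]; linarith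
    linarith
  -- Large enough that 1 + b² ≥ 64 · 54 y, so `le_odds` gives an upper end point for the
  -- intermediate value theorem.
  set b := 100 * (1 + y)
  have hb : 1 ≤ b := by simp only [b]; linarith
  have hby : y ≤ odds b := by
    refine le_trans ?_ (le_odds hb)
    rw [le_div_iff₀ (by positivity)]
    have h := one_add_sq_le_exp (sq_nonneg b)
    have h2 : Real.exp (b ^ 2 / 4) ≤ Real.exp (b ^ 2 / 2) :=
      Real.exp_le_exp.2 (by nlinarith)
    have h3 : 64 * (54 * y) ≤ 1 + b ^ 2 := by simp only [b]; nlinarith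
    nlinarith [sq_nonneg b]
  obtain ⟨t, ht, hty⟩ := intermediate_value_Icc (by linarith : (0 : ℝ) ≤ b)
    continuous_odds.continuousOn ⟨odds_zero.trans_le hy, hby⟩
  refine ⟨t, ht.1, ?_⟩
  rw [weightOf, hty]
  simp [y]

/-- Every weight in (0, 1] is some `weightOf s`, with threshold s, so the preimage picked by
`invFunOn` is unique. -/
theorem thresholdInv_eq_weightOf {t : ℝ} (ht : 0 ≤ t) : thresholdInv t = weightOf t := by
  have hex : ∃ a ∈ Set.Ioc (0 : ℝ) 1, threshold a = t :=
    ⟨weightOf t, weightOf_mem ht, threshold_weightOf ht⟩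
  have hm : thresholdInv t ∈ Set.Ioc (0 : ℝ) 1 := Function.invFunOn_mem hex
  have he : threshold (thresholdInv t) = t := Function.invFunOn_eq hex
  obtain ⟨s, hs, hsα⟩ := exists_eq_weightOf hm.1 hm.2
  rw [← hsα, threshold_weightOf hs] at he
  rw [← hsα, he]

theorem threshold_le_iff {α t : ℝ} (h0 : 0 < α) (h1 : α ≤ 1) (ht : 0 ≤ t) :
    threshold α ≤ t ↔ weightOf t ≤ α := by
  obtain ⟨s, hs, rfl⟩ := exists_eq_weightOf h0 h1
  rw [threshold_weightOf hs, weightOf_strictAntiOn.le_iff_ge ht hs]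

theorem weightOf_le {t : ℝ} (ht : 1 ≤ t) :
    weightOf t ≤ 54 * (1 + t ^ 2) * Real.exp (-t ^ 2 / 2) := by
  have h := le_odds ht
  have hp : 0 < Real.exp (t ^ 2 / 2) / (54 * (1 + t ^ 2)) := by positivity
  have e : 54 * (1 + t ^ 2) * Real.exp (-t ^ 2 / 2) =
      1 / (Real.exp (t ^ 2 / 2) / (54 * (1 + t ^ 2))) := by
    rw [neg_div, Real.exp_neg]; field_simp
  rw [e, weightOf]
  exact one_div_le_one_div_of_le hp (by linarith)

theorem le_weightOf {t : ℝ} (ht : 0 ≤ t) :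
    1 / (1 + 6 * Real.exp (t ^ 2 / 2) / (1 + t ^ 2)) ≤ weightOf t := by
  have := odds_nonneg ht
  have := odds_le t
  exact one_div_le_one_div_of_le (by positivity) (by linarith)

/-! ### Coordinatewise bound on the posterior loss -/

theorem exists_lintegral_slabPosterior_le : ∃ C : ℝ, 2 ≤ C ∧ ∀ θ x : ℝ,
    ∫⁻ u, ENNReal.ofReal ((u - θ) ^ 2) ∂slabPosterior x ≤
      ENNReal.ofReal (2 * (x - θ) ^ 2 + C) := by
  obtain ⟨C, hC, h⟩ := exists_slab_moment_le
  -- The surplus 2 ensures that the constant is at least 2, which later absorbs w(2x² + C) into C(1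
  -- + x²)w on noise coordinates.
  refine ⟨72 * C + 2, by linarith, fun θ x => ?_⟩
  obtain ⟨hi, hle⟩ := h x
  have hg := g_pos x
  have hx : ∫⁻ u, ENNReal.ofReal ((u - x) ^ 2) ∂slabPosterior x ≤ ENNReal.ofReal (36 * C) := by
    have hm : Measurable fun u => ENNReal.ofReal (phi (x - u) * slab u / g x) := by
      have h1 : Continuous fun u => phi (x - u) := continuous_phi.comp (by fun_prop)
      have h2 := continuous_slab
      exact (Continuous.measurable (by fun_prop)).ennreal_ofReal
    rw [slabPosterior, lintegral_withDensity_eq_lintegral_mul _ hm (by fun_prop)]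
    have e : ∀ u, ((fun u => ENNReal.ofReal (phi (x - u) * slab u / g x)) *
        fun u => ENNReal.ofReal ((u - x) ^ 2)) u =
        ENNReal.ofReal ((u - x) ^ 2 * (phi (x - u) * slab u) / g x) := fun u => by
      have : 0 ≤ phi (x - u) * slab u / g x :=
        div_nonneg (mul_nonneg (phi_pos _).le (slab_pos _).le) hg.le
      rw [Pi.mul_apply, ← ENNReal.ofReal_mul this]
      congr 1
      ring
    simp only [e]
    rw [← ofReal_integral_eq_lintegral_ofReal (hi.div_const _), integral_div]
    · apply ENNReal.ofReal_le_ofReal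
      rw [div_le_iff₀ hg]
      calc _ ≤ C / (1 + x ^ 2) := hle
        _ = 36 * C * (1 / 36 / (1 + x ^ 2)) := by ring
        _ ≤ _ := by gcongr; exact le_g x
    · refine Filter.Eventually.of_forall fun u => ?_
      have := phi_pos (x - u)
      have := slab_pos u
      simp only [Pi.zero_apply]
      positivity
  calc ∫⁻ u, ENNReal.ofReal ((u - θ) ^ 2) ∂slabPosterior x
      ≤ ∫⁻ u, (ENNReal.ofReal 2 * ENNReal.ofReal ((u - x) ^ 2) +
          ENNReal.ofReal (2 * (x - θ) ^ 2)) ∂slabPosterior x := by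
        refine lintegral_mono fun u => ?_
        simp only
        rw [← ENNReal.ofReal_mul (by norm_num), ← ENNReal.ofReal_add (by positivity)
          (by positivity)]
        apply ENNReal.ofReal_le_ofReal
        nlinarith [sq_nonneg (u - x - (x - θ))]
    _ ≤ ENNReal.ofReal 2 * ENNReal.ofReal (36 * C) + ENNReal.ofReal (2 * (x - θ) ^ 2) := by
        rw [lintegral_add_right _ measurable_const, lintegral_const_mul _ (by fun_prop),
          lintegral_const, measure_univ, mul_one]
        gcongr
    _ ≤ _ := by
        rw [← ENNReal.ofReal_mul (by norm_num), ← ENNReal.ofReal_add (by positivity)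
          (by positivity)]
        apply ENNReal.ofReal_le_ofReal
        linarith

theorem exists_posteriorLoss_le : ∃ C : ℝ, 2 ≤ C ∧ ∀ (n : ℕ) (α : ℝ) (θ X : Fin n → ℝ),
    0 < α → α ≤ 1 → posteriorLoss α θ X ≤ ENNReal.ofReal (∑ i, ((1 - weight α (X i)) * θ i ^ 2 +
      weight α (X i) * (2 * (X i - θ i) ^ 2 + C))) := by
  obtain ⟨C, hC, h⟩ := exists_lintegral_slabPosterior_le
  refine ⟨C, hC, fun n α θ X h0 h1 => ?_⟩
  have hp : ∀ i, IsProbabilityMeasure (coordPosterior α (X i)) := fun i =>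
    isProbabilityMeasure_coordPosterior h0 h1 _
  have hw := weight_nonneg h0 h1
  have hw' := weight_le_one h0 h1
  rw [posteriorLoss, posterior]
  simp only [ENNReal.ofReal_sum_of_nonneg fun i _ => sq_nonneg _]
  rw [lintegral_finsetSum _ fun i _ => by fun_prop, ENNReal.ofReal_sum_of_nonneg]
  · refine Finset.sum_le_sum fun i _ => ?_
    have hmap := (measurePreserving_eval (fun i => coordPosterior α (X i)) i).lintegral_comp
      (f := fun u => ENNReal.ofReal ((u - θ i) ^ 2)) (by fun_prop)
    simp only [Function.eval] at hmap
    rw [hmap, coordPosterior, lintegral_add_measure, lintegral_smul_measure,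
      lintegral_smul_measure, lintegral_dirac]
    have hwi := hw (X i)
    have hwi' : 0 ≤ 1 - weight α (X i) := sub_nonneg.2 (hw' (X i))
    simp only [smul_eq_mul, zero_sub, neg_sq]
    rw [ENNReal.ofReal_add (by positivity) (by positivity), ENNReal.ofReal_mul hwi',
      ENNReal.ofReal_mul hwi]
    gcongr
    exact h _ _
  · intro i _
    have hwi := hw (X i)
    have hwi' : 0 ≤ 1 - weight α (X i) := sub_nonneg.2 (hw' (X i))
    positivity

/-! ### Score and likelihood equation -/

/-- The marginal density of an observation, for prior weight `α`. -/
noncomputable def den (α x : ℝ) : ℝ := (1 - α) * phi x + α * g x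

/-- The derivative of the log-marginal likelihood. -/
noncomputable def score {n : ℕ} (X : Fin n → ℝ) (α : ℝ) : ℝ :=
  ∑ i, (g (X i) - phi (X i)) / den α (X i)

/-- The tangent inequality of a concave function, without derivatives: log u ≤ u - 1 for the ratio
of marginal densities, which are affine in the weight. -/
theorem logLik_sub_le {n : ℕ} (X : Fin n → ℝ) {α β : ℝ} (hα : α ∈ Set.Ioc 0 1)
    (hβ : β ∈ Set.Ioc 0 1) : logLik X α - logLik X β ≤ (α - β) * score X β := by
  rw [logLik, logLik, score, ← Finset.sum_sub_distrib, Finset.mul_sum]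
  refine Finset.sum_le_sum fun i _ => ?_
  have h1 := den_pos hα.1 hα.2 (X i)
  have h2 := den_pos hβ.1 hβ.2 (X i)
  rw [← Real.log_div h1.ne' h2.ne']
  refine (Real.log_le_sub_one_of_pos (div_pos h1 h2)).trans (le_of_eq ?_)
  change _ / den β (X i) - 1 = _
  have hd : den β (X i) ≠ 0 := h2.ne'
  rw [← mul_div_assoc, div_sub_one hd, den]
  ring

theorem score_nonneg_of_lt {n : ℕ} {X : Fin n → ℝ} {l a b : ℝ} (hl : 0 < l)
    (ha : a ∈ Set.Icc l 1) (hmax : IsMaxOn (logLik X) (Set.Icc l 1) a) (hb : l ≤ b)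
    (hba : b < a) : 0 ≤ score X b := by
  have h1 := logLik_sub_le X (α := a) (β := b) ⟨by linarith [ha.1], ha.2⟩
    ⟨by linarith, by linarith [ha.2]⟩
  have h2 : logLik X b ≤ logLik X a := hmax ⟨hb, by linarith [ha.2]⟩
  exact nonneg_of_mul_nonneg_right (by linarith : 0 ≤ (a - b) * score X b) (by linarith)

theorem continuousAt_score {n : ℕ} (X : Fin n → ℝ) {a : ℝ} (h0 : 0 < a) (h1 : a ≤ 1) :
    ContinuousAt (score X) a := by
  unfold score
  refine tendsto_finsetSum _ fun i _ => ContinuousAt.div continuousAt_const ?_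
    (den_pos h0 h1 (X i)).ne'
  unfold den
  fun_prop

/-- The tangent inequality at b > a forces a nonpositive score at b; then b ↓ a. Points to the left
are never used, so a may be the left end point. -/
theorem score_nonpos_of_isMaxOn {n : ℕ} {X : Fin n → ℝ} {l a : ℝ} (hl : 0 < l)
    (ha : a ∈ Set.Icc l 1) (hmax : IsMaxOn (logLik X) (Set.Icc l 1) a) (ha1 : a < 1) :
    score X a ≤ 0 := by
  have h0 : 0 < a := by linarith [ha.1]
  have ht := (continuousAt_score X h0 ha.2).tendsto.mono_left
    (nhdsWithin_le_nhds (s := Set.Ioi a))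
  refine le_of_tendsto ht ?_
  filter_upwards [Ioc_mem_nhdsGT ha1] with b hb
  have h1 := logLik_sub_le X (α := a) (β := b) ⟨h0, ha.2⟩ ⟨by linarith [hb.1], hb.2⟩
  have h2 : logLik X b ≤ logLik X a := hmax ⟨by linarith [hb.1, ha.1], hb.2⟩
  by_contra h
  push Not at h
  nlinarith [hb.1]

/-- The likelihood equation, as an inequality that also covers the end points. -/
theorem sum_g_div_den_le {n : ℕ} {X : Fin n → ℝ} {l a : ℝ} (hl : 0 < l)
    (ha : a ∈ Set.Icc l 1) (hmax : IsMaxOn (logLik X) (Set.Icc l 1) a) :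
    ∑ i, g (X i) / den a (X i) ≤ n := by
  have h0 : 0 < a := by linarith [ha.1]
  -- Termwise, g = den + (1 - a)(g - φ). The factor 1 - a removes the score at a = 1, where its sign
  -- is unknown.
  have e : ∑ i, g (X i) / den a (X i) = n + (1 - a) * score X a := by
    rw [score, Finset.mul_sum]
    have : (n : ℝ) = ∑ _i : Fin n, (1 : ℝ) := by simp
    rw [this, ← Finset.sum_add_distrib]
    refine Finset.sum_congr rfl fun i _ => ?_
    have hd : den a (X i) ≠ 0 := (den_pos h0 ha.2 (X i)).ne'
    rw [div_eq_iff hd, add_mul, mul_assoc, div_mul_cancel₀ _ hd, den]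
    ring
  rw [e]
  rcases ha.2.lt_or_eq with h | h
  · nlinarith [score_nonpos_of_isMaxOn hl ha hmax h]
  · simp [h]

/-! ### Cost of shrinking a signal -/

theorem g_div_den_nonneg {α : ℝ} (h0 : 0 < α) (h1 : α ≤ 1) (x : ℝ) : 0 ≤ g x / den α x :=
  div_nonneg (g_pos x).le (den_pos h0 h1 x).le

theorem g_div_den_le {α : ℝ} (h0 : 0 < α) (h1 : α ≤ 1) (x : ℝ) : g x / den α x ≤ 1 / α := by
  have hd : 0 < den α x := den_pos h0 h1 x
  rw [div_le_div_iff₀ hd h0, den]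
  nlinarith [mul_nonneg (sub_nonneg.2 h1) (phi_pos x).le]

theorem one_sub_weight_mul_sq_le {α : ℝ} (h0 : 0 < α) (h1 : α ≤ 1) (x : ℝ) :
    (1 - weight α x) * x ^ 2 ≤ 1152 * Real.exp (-x ^ 2 / 4) * (g x / den α x) := by
  have hd : 0 < den α x := den_pos h0 h1 x
  rw [one_sub_weight h0 h1, ← mul_div_assoc]
  change (1 - α) * phi x / den α x * x ^ 2 ≤ _
  rw [div_mul_eq_mul_div]
  refine div_le_div_of_nonneg_right ?_ hd.le
  refine le_trans ?_ (phi_le_mul_g x)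
  have : 0 ≤ phi x * x ^ 2 := mul_nonneg (phi_pos x).le (sq_nonneg x)
  nlinarith [phi_pos x]

theorem one_sub_weight_mul_sq_le_sq {α : ℝ} (h0 : 0 < α) (h1 : α ≤ 1) (x : ℝ) :
    (1 - weight α x) * x ^ 2 ≤ x ^ 2 := by
  nlinarith [weight_nonneg h0 h1 x, sq_nonneg x]

theorem exp_neg_log_div {N s : ℝ} (hN : 0 < N) (hs : 0 < s) :
    Real.exp (-Real.log (N / s)) = s / N := by
  rw [Real.exp_neg, Real.exp_log (by positivity), inv_div]

/-- The split is at x² = 4 log(N/s), where e^{-x²/4} = s/N. This factor offsets the bound N on the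
sum of g/den from the likelihood equation. -/
theorem one_sub_weight_mul_sq_le_log_add {α N s : ℝ} (h0 : 0 < α) (h1 : α ≤ 1) (hs : 0 < s)
    (hsN : s ≤ N) (x : ℝ) :
    (1 - weight α x) * x ^ 2 ≤ 4 * Real.log (N / s) + 1152 * (s / N) * (g x / den α x) := by
  have hN : 0 < N := by linarith
  have hq := g_div_den_nonneg h0 h1 x
  have hl : 0 ≤ Real.log (N / s) := Real.log_nonneg (by rw [le_div_iff₀ hs]; linarith)
  by_cases hx : x ^ 2 ≤ 4 * Real.log (N / s)
  · have := one_sub_weight_mul_sq_le_sq h0 h1 x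
    have : 0 ≤ 1152 * (s / N) * (g x / den α x) := by positivity
    linarith
  · have := one_sub_weight_mul_sq_le h0 h1 x
    have he : Real.exp (-x ^ 2 / 4) ≤ s / N := by
      rw [← exp_neg_log_div hN hs]
      exact Real.exp_le_exp.2 (by linarith)
    have : 1152 * Real.exp (-x ^ 2 / 4) * (g x / den α x) ≤
        1152 * (s / N) * (g x / den α x) := by gcongr
    linarith

/-- Beyond B the Gaussian factor beats the crude bound g/den ≤ 1/α. It serves the modified weight,
with B of order log n. -/
theorem one_sub_weight_mul_sq_le_of_exp_le {α B : ℝ} (h0 : 0 < α) (h1 : α ≤ 1)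
    (hB : 1152 * Real.exp (-B / 4) ≤ α) (hB0 : 0 ≤ B) (x : ℝ) :
    (1 - weight α x) * x ^ 2 ≤ B + 1 := by
  by_cases hx : x ^ 2 ≤ B
  · linarith [one_sub_weight_mul_sq_le_sq h0 h1 x]
  · have h := one_sub_weight_mul_sq_le h0 h1 x
    have he : Real.exp (-x ^ 2 / 4) ≤ Real.exp (-B / 4) := Real.exp_le_exp.2 (by linarith)
    have : 1152 * Real.exp (-x ^ 2 / 4) * (g x / den α x) ≤ α * (1 / α) :=
      mul_le_mul (by linarith) (g_div_den_le h0 h1 x) (g_div_den_nonneg h0 h1 x) h0.le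
    rw [mul_one_div_cancel h0.ne'] at this
    linarith

/-- A signal whose weight is computed with `α` is controlled by the likelihood equation for
another, small value `a` of the prior weight. -/
theorem one_sub_weight_mul_sq_le_of_small {α a B N s : ℝ} (h0 : 0 < α) (h1 : α ≤ 1)
    (hB : 1152 * Real.exp (-B / 4) ≤ α) (hB0 : 0 ≤ B) (ha0 : 0 < a) (ha1 : a ≤ 1) (hs : 0 < s)
    (hsN : s ≤ N) (ha : (B + 1) * a ≤ 1152 * (s / N)) (x : ℝ) :
    (1 - weight α x) * x ^ 2 ≤ 4 * Real.log (N / s) + 2304 * (s / N) * (g x / den a x) := by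
  have hN : 0 < N := by linarith
  have hq := g_div_den_nonneg ha0 ha1 x
  have hd : 0 < den a x := den_pos ha0 ha1 x
  have hg := g_pos x
  have hφ := phi_pos x
  have hl : 0 ≤ Real.log (N / s) := Real.log_nonneg (by rw [le_div_iff₀ hs]; linarith)
  by_cases hx : x ^ 2 ≤ 4 * Real.log (N / s)
  · have := one_sub_weight_mul_sq_le_sq h0 h1 x
    have : 0 ≤ 2304 * (s / N) * (g x / den a x) := by positivity
    linarith
  suffices (1 - weight α x) * x ^ 2 ≤ 2304 * (s / N) * (g x / den a x) by linarith
  rw [← mul_div_assoc, le_div_iff₀ hd]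
  have he : Real.exp (-x ^ 2 / 4) ≤ s / N := by
    rw [← exp_neg_log_div hN hs]
    exact Real.exp_le_exp.2 (by linarith)
  have hw : 0 ≤ (1 - weight α x) * x ^ 2 :=
    mul_nonneg (sub_nonneg.2 (weight_le_one h0 h1 x)) (sq_nonneg x)
  -- If the spike dominates `den a`, Gaussian decay of φ/g suffices; otherwise `den a` is at most
  -- 2ag, and the smallness of a pays for B + 1.
  by_cases hc : a * g x ≤ phi x
  · have hdle : den a x ≤ 2 * phi x := by rw [den]; nlinarith
    have h3 := phi_le_mul_g x
    calc _ ≤ x ^ 2 * (2 * phi x) :=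
          mul_le_mul (one_sub_weight_mul_sq_le_sq h0 h1 x) hdle hd.le (sq_nonneg x)
      _ ≤ 2 * ((1 + x ^ 2) * phi x) := by nlinarith
      _ ≤ 2 * (1152 * Real.exp (-x ^ 2 / 4) * g x) := by linarith
      _ ≤ 2 * (1152 * (s / N) * g x) := by gcongr
      _ = _ := by ring
  · have hdle : den a x ≤ 2 * (a * g x) := by rw [den]; nlinarith
    calc _ ≤ (B + 1) * (2 * (a * g x)) :=
          mul_le_mul (one_sub_weight_mul_sq_le_of_exp_le h0 h1 hB hB0 x) hdle hd.le
            (by linarith)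
      _ = 2 * ((B + 1) * a) * g x := by ring
      _ ≤ 2 * (1152 * (s / N)) * g x := by gcongr
      _ = _ := by ring

/-! ### Noise risk at a fixed prior weight -/

theorem weight_mono {α β : ℝ} (h0 : 0 < α) (h : α ≤ β) (h1 : β ≤ 1) (x : ℝ) :
    weight α x ≤ weight β x := by
  rw [weight, weight, div_le_div_iff₀ (den_pos h0 (h.trans h1) x)
    (den_pos (h0.trans_le h) h1 x)]
  nlinarith [mul_nonneg (sub_nonneg.2 h) (mul_pos (phi_pos x) (g_pos x)).le]

theorem lintegral_gaussianReal_le {f h : ℝ → ℝ} (hfh : ∀ x, phi x * f x ≤ h x)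
    (hf : ∀ x, 0 ≤ f x) (hh : Integrable h) {c : ℝ} (hc : ∫ x, h x ≤ c) :
    ∫⁻ x, ENNReal.ofReal (f x) ∂gaussianReal 0 1 ≤ ENNReal.ofReal c := by
  rw [gaussianReal_of_var_ne_zero _ one_ne_zero]
  refine (lintegral_withDensity_le_lintegral_mul _ (measurable_gaussianPDF 0 1) _).trans ?_
  calc _ ≤ ∫⁻ x, ENNReal.ofReal (h x) := by
        refine lintegral_mono fun x => ?_
        rw [Pi.mul_apply, gaussianPDF, ← ENNReal.ofReal_mul (gaussianPDFReal_nonneg _ _ _)]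
        exact ENNReal.ofReal_le_ofReal (hfh x)
    _ = ENNReal.ofReal (∫ x, h x) :=
        (ofReal_integral_eq_lintegral_ofReal hh (Filter.Eventually.of_forall fun x =>
          (mul_nonneg (phi_pos x).le (hf x)).trans (hfh x))).symm
    _ ≤ _ := ENNReal.ofReal_le_ofReal hc

theorem integral_exp_neg_sq_div_eight_le : ∫ x : ℝ, Real.exp (-(1 / 8) * x ^ 2) ≤ 6 := by
  rw [integral_gaussian]
  apply Real.sqrt_le_iff.2 ⟨by norm_num, ?_⟩
  rw [div_le_iff₀ (by norm_num)]
  linarith [Real.pi_le_four]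

/-- The contribution of a zero coefficient to the risk. -/
theorem lintegral_noise_le {α z : ℝ} (h0 : 0 < α) (h1 : α ≤ 1 / 2) (hz : 0 ≤ z) :
    ∫⁻ x, ENNReal.ofReal ((1 + x ^ 2) * weight α x) ∂gaussianReal 0 1 ≤
      ENNReal.ofReal (8 * α * z + 24 * Real.exp (-z ^ 2 / 4)) := by
  have hα1 : α ≤ 1 := by linarith
  have hi1 : Integrable (Set.indicator (Set.Icc (-z) z) fun _ : ℝ => 4 * α) :=
    (integrable_indicator_iff measurableSet_Icc).2 (integrableOn_const (by simp))
  have hi2 : Integrable fun x : ℝ => 4 * Real.exp (-z ^ 2 / 4) * Real.exp (-(1 / 8) * x ^ 2) :=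
    (integrable_exp_neg_mul_sq (by norm_num)).const_mul _
  refine lintegral_gaussianReal_le (h := fun x => Set.indicator (Set.Icc (-z) z)
    (fun _ : ℝ => 4 * α) x + 4 * Real.exp (-z ^ 2 / 4) * Real.exp (-(1 / 8) * x ^ 2))
    (fun x => ?_) (fun x => mul_nonneg (by positivity) (weight_nonneg h0 hα1 x))
    (hi1.add hi2) ?_
  · have hφ := phi_pos x
    have hg := g_pos x
    have hd := den_pos h0 hα1 x
    have hw := weight_nonneg h0 hα1 x
    by_cases hx : x ∈ Set.Icc (-z) z
    · rw [Set.indicator_of_mem hx]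
      -- As 1 - α ≥ 1/2, the marginal density is at least φ/2.
      have h3 : phi x * weight α x ≤ 2 * α * g x := by
        rw [weight, ← mul_div_assoc, div_le_iff₀ hd]
        have : 0 ≤ α * g x * ((1 / 2 - α) * phi x + α * g x) :=
          mul_nonneg (by positivity) (add_nonneg (mul_nonneg (by linarith) hφ.le) (by positivity))
        nlinarith
      have h4 := g_le x
      rw [le_div_iff₀ (by positivity)] at h4
      have h5 : 0 ≤ 4 * Real.exp (-z ^ 2 / 4) * Real.exp (-(1 / 8) * x ^ 2) := by positivity
      calc phi x * ((1 + x ^ 2) * weight α x) = (1 + x ^ 2) * (phi x * weight α x) := by ring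
        _ ≤ (1 + x ^ 2) * (2 * α * g x) := by gcongr
        _ = 2 * α * (g x * (1 + x ^ 2)) := by ring
        _ ≤ 2 * α * 2 := by gcongr
        _ ≤ _ := by linarith
    · rw [Set.indicator_of_notMem hx, zero_add]
      have hxz : z ^ 2 ≤ x ^ 2 := by
        rw [sq_le_sq, abs_of_nonneg hz]
        by_contra h
        exact hx (abs_le.1 (not_le.1 h).le)
      have h3 := phi_le x
      -- The exponent 1/2 splits as 1/4 + 1/8 + 1/8: one part yields the decay in z, one absorbs 1 +
      -- x², one stays integrable.
      have e1 : Real.exp (-x ^ 2 / 2) = Real.exp (-x ^ 2 / 4) *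
          (Real.exp (-(1 / 8) * x ^ 2) * Real.exp (-(1 / 8) * x ^ 2)) := by
        rw [← Real.exp_add, ← Real.exp_add]; ring_nf
      have e2 : Real.exp (-x ^ 2 / 4) ≤ Real.exp (-z ^ 2 / 4) := Real.exp_le_exp.2 (by linarith)
      have e3 : (1 + x ^ 2) * Real.exp (-(1 / 8) * x ^ 2) ≤ 8 := by
        have h := Real.add_one_le_exp (x ^ 2 / 8)
        have : Real.exp (x ^ 2 / 8) * Real.exp (-(1 / 8) * x ^ 2) = 1 := by
          rw [← Real.exp_add]; ring_nf; exact Real.exp_zero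
        have hp := Real.exp_pos (-(1 / 8) * x ^ 2)
        nlinarith
      have hw1 := weight_le_one h0 hα1 x
      set E := Real.exp (-(1 / 8) * x ^ 2)
      have hE : 0 < E := Real.exp_pos _
      have hF := Real.exp_pos (-x ^ 2 / 4)
      calc phi x * ((1 + x ^ 2) * weight α x) ≤ phi x * ((1 + x ^ 2) * 1) := by gcongr
        _ ≤ 1 / 2 * (Real.exp (-x ^ 2 / 4) * (E * E)) * ((1 + x ^ 2) * 1) := by
            rw [← e1]; gcongr
        _ = 1 / 2 * Real.exp (-x ^ 2 / 4) * E * ((1 + x ^ 2) * E) := by ring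
        _ ≤ 1 / 2 * Real.exp (-z ^ 2 / 4) * E * 8 := by gcongr
        _ = _ := by ring
  · have hE := Real.exp_pos (-z ^ 2 / 4)
    rw [integral_add hi1 hi2, integral_indicator measurableSet_Icc, setIntegral_const,
      integral_const_mul]
    simp only [measureReal_def, Real.volume_Icc, smul_eq_mul]
    rw [ENNReal.toReal_ofReal (by linarith)]
    nlinarith [integral_exp_neg_sq_div_eight_le]

/-! ### Exponential moment of the score under noise -/

/-- A multiple of the score of one observation, bounded above by `1 / 2`. -/
noncomputable def tilt (α x : ℝ) : ℝ := 1 / 2 * (α * (g x - phi x) / den α x)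

theorem tilt_le {α : ℝ} (h0 : 0 < α) (h1 : α ≤ 1) (x : ℝ) : tilt α x ≤ 1 / 2 := by
  have hd : 0 < den α x := den_pos h0 h1 x
  have : α * (g x - phi x) / den α x ≤ 1 := by
    rw [div_le_one hd, den]; linarith [phi_pos x]
  rw [tilt]; linarith

theorem measurable_tilt (α : ℝ) : Measurable (tilt α) := by
  have h1 := continuous_phi.measurable
  have h2 := continuous_g.measurable
  unfold tilt den
  fun_prop

theorem exp_tilt_le_two {α : ℝ} (h0 : 0 < α) (h1 : α ≤ 1) (x : ℝ) : Real.exp (tilt α x) ≤ 2 := by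
  refine (Real.exp_le_exp.2 (tilt_le h0 h1 x)).trans ?_
  have h := Real.abs_exp_sub_one_sub_id_le (x := 1 / 2) (by norm_num [abs_of_pos])
  have := (abs_le.1 h).2
  linarith

/-- With q = α(g - φ)/den one has φ = (1 - q) den and e^{q/2} ≤ 1 + q/2 + q²/4. The product is den
times 1 - q/2 - q²/4 - q³/4, and q ≥ -1/3, which follows from α ≤ 1/4, keeps -q²/6 of the quadratic
gain. -/
theorem phi_mul_exp_tilt_le {α : ℝ} (h0 : 0 < α) (h1 : α ≤ 1 / 4) (x : ℝ) :
    phi x * Real.exp (tilt α x) ≤ phi x + 1 / 2 * (α * (g x - phi x)) -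
      1 / 6 * ((α * (g x - phi x)) ^ 2 / den α x) := by
  have hφ := phi_pos x
  have hg := g_pos x
  have hd : 0 < den α x := den_pos h0 (by linarith) x
  have hden : den α x = phi x + α * (g x - phi x) := by rw [den]; ring
  set q := α * (g x - phi x) / den α x with hq
  have hqd : q * den α x = α * (g x - phi x) := div_mul_cancel₀ _ hd.ne'
  have hq1 : q ≤ 1 := by rw [hq, div_le_one hd]; linarith
  have hq2 : -(1 / 3) ≤ q := by
    rw [hq, le_div_iff₀ hd, hden]
    nlinarith
  have ht : tilt α x = 1 / 2 * q := rfl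
  have hexp : Real.exp (tilt α x) ≤ 1 + 1 / 2 * q + (1 / 2 * q) ^ 2 := by
    have h := Real.abs_exp_sub_one_sub_id_le (x := tilt α x)
      (by rw [ht, abs_le]; constructor <;> linarith)
    have := (abs_le.1 h).2
    rw [ht] at this ⊢
    linarith
  have hsq : (α * (g x - phi x)) ^ 2 / den α x = q ^ 2 * den α x := by
    rw [← hqd]; field_simp
  have hp : phi x = (1 - q) * den α x := by rw [sub_mul, one_mul, hqd, hden]; ring
  rw [hsq, ← hqd]
  calc phi x * Real.exp (tilt α x) ≤ phi x * (1 + 1 / 2 * q + (1 / 2 * q) ^ 2) := by gcongr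
    _ ≤ _ := by
      rw [hp]
      have : 0 ≤ q ^ 2 * (1 / 12 + q / 4) * den α x :=
        mul_nonneg (mul_nonneg (sq_nonneg q) (by linarith)) hd.le
      nlinarith

/-- Far out 2φ ≤ αg, hence q ≥ 1/2 and the quadratic gain is proportional to αg. -/
theorem phi_mul_exp_tilt_le_sub {α : ℝ} (h0 : 0 < α) (h1 : α ≤ 1 / 4) {x : ℝ}
    (hx : 2304 * Real.exp (-x ^ 2 / 4) ≤ α) :
    phi x * Real.exp (tilt α x) ≤ phi x + 1 / 2 * (α * (g x - phi x)) - α / 24 * g x := by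
  refine (phi_mul_exp_tilt_le h0 h1 x).trans ?_
  have hφ := phi_pos x
  have hg := g_pos x
  have hd : 0 < den α x := den_pos h0 (by linarith) x
  have hden : den α x = phi x + α * (g x - phi x) := by rw [den]; ring
  have h3 : 2 * phi x ≤ α * g x := by
    have := phi_le_exp_mul_g x
    nlinarith
  have h4 : phi x ≤ α * (g x - phi x) := by nlinarith
  have h5 : 1 / 2 * (α * g x) ≤ α * (g x - phi x) := by nlinarith
  have h6 : 1 / 2 * (α * (g x - phi x)) ≤ (α * (g x - phi x)) ^ 2 / den α x := by
    rw [le_div_iff₀ hd, hden]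
    nlinarith
  linarith

theorem le_setIntegral_g {z : ℝ} (hz : 1 ≤ z) : 1 / (72 * z) ≤ ∫ x in Set.Ioi z, g x := by
  have hz0 : 0 < z := by linarith
  have hi := integrableOn_Ioi_rpow_of_lt (a := -2) (by norm_num) hz0
  have e := integral_Ioi_rpow_of_lt (a := -2) (by norm_num) hz0
  calc 1 / (72 * z) = ∫ x in Set.Ioi z, 1 / 72 * x ^ (-2 : ℝ) := by
        rw [integral_const_mul, e]
        norm_num [Real.rpow_neg hz0.le]
        ring
    _ ≤ _ := by
        refine setIntegral_mono_on (hi.const_mul _) integrable_g.integrableOn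
          measurableSet_Ioi fun x hx => ?_
        have hx : z < x := hx
        have hx0 : 0 < x := by linarith
        refine le_trans ?_ (le_g x)
        have h2 : (2 * x ^ 2)⁻¹ ≤ (1 + x ^ 2)⁻¹ := inv_anti₀ (by positivity) (by nlinarith)
        rw [Real.rpow_neg hx0.le, Real.rpow_two, div_eq_mul_inv _ (1 + x ^ 2)]
        calc _ = 1 / 36 * (2 * x ^ 2)⁻¹ := by rw [mul_inv]; ring
          _ ≤ _ := by gcongr

/-- The first-order term integrates to zero because g and φ both have mass one. What is left is the
gain α/24 times the tail mass of g beyond z, at least 1/(72z). -/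
theorem lintegral_exp_tilt_le {α z : ℝ} (h0 : 0 < α) (h1 : α ≤ 1 / 4) (hz : 1 ≤ z)
    (hαz : 2304 * Real.exp (-z ^ 2 / 4) ≤ α) :
    ∫⁻ x, ENNReal.ofReal (Real.exp (tilt α x)) ∂gaussianReal 0 1 ≤
      ENNReal.ofReal (Real.exp (-(α / (1728 * z)))) := by
  have hi0 : Integrable fun x => 1 / 2 * (α * (g x - phi x)) :=
    ((integrable_g.sub integrable_phi).const_mul _).const_mul _
  have hi1 : Integrable fun x => phi x + 1 / 2 * (α * (g x - phi x)) := integrable_phi.add hi0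
  have hi2 : Integrable (Set.indicator (Set.Ioi z) fun x => α / 24 * g x) :=
    (integrable_g.const_mul _).indicator measurableSet_Ioi
  refine lintegral_gaussianReal_le (h := fun x => (phi x + 1 / 2 * (α * (g x - phi x))) -
    Set.indicator (Set.Ioi z) (fun x => α / 24 * g x) x) (fun x => ?_)
    (fun x => (Real.exp_pos _).le) (hi1.sub hi2) ?_
  · by_cases hx : x ∈ Set.Ioi z
    · rw [Set.indicator_of_mem hx]
      refine phi_mul_exp_tilt_le_sub h0 h1 (le_trans ?_ hαz)
      have hx : z < x := hx
      have : Real.exp (-x ^ 2 / 4) ≤ Real.exp (-z ^ 2 / 4) := Real.exp_le_exp.2 (by nlinarith)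
      linarith
    · rw [Set.indicator_of_notMem hx]
      have hd : 0 < den α x := den_pos h0 (by linarith) x
      have : 0 ≤ (α * (g x - phi x)) ^ 2 / den α x := by positivity
      linarith [phi_mul_exp_tilt_le h0 h1 x]
  · rw [integral_sub hi1 hi2, integral_indicator measurableSet_Ioi, integral_const_mul,
      integral_add integrable_phi hi0, integral_const_mul, integral_const_mul, integral_sub integrable_g integrable_phi, integral_g, integral_phi]
    have h3 := le_setIntegral_g hz
    have h4 : α / (1728 * z) = α / 24 * (1 / (72 * z)) := by field_simp; norm_num
    have h5 : α / 24 * (1 / (72 * z)) ≤ α / 24 * ∫ x in Set.Ioi z, g x := by gcongr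
    have h6 := Real.add_one_le_exp (-(α / (1728 * z)))
    linarith

theorem lintegral_sq_mul_exp_tilt_le {α : ℝ} (h0 : 0 < α) (h1 : α ≤ 1) :
    ∫⁻ x, ENNReal.ofReal ((1 + x ^ 2) * Real.exp (tilt α x)) ∂gaussianReal 0 1 ≤
      ENNReal.ofReal 4 := by
  refine lintegral_gaussianReal_le (h := fun x => 2 * (phi x + x ^ 2 * phi x)) (fun x => ?_)
    (fun x => by positivity) ((integrable_phi.add integrable_sq_mul_phi).const_mul _) ?_
  · have := exp_tilt_le_two h0 h1 x
    have hφ := phi_pos x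
    calc phi x * ((1 + x ^ 2) * Real.exp (tilt α x)) ≤ phi x * ((1 + x ^ 2) * 2) := by gcongr
      _ = _ := by ring
  · rw [integral_const_mul, integral_add integrable_phi integrable_sq_mul_phi, integral_phi,
      integral_sq_mul_phi]
    norm_num

/-! ### Chernoff bound for the event of a nonnegative score -/

instance isProbabilityMeasure_dataLaw {n : ℕ} (θ : Fin n → ℝ) :
    IsProbabilityMeasure (dataLaw θ) := by
  unfold dataLaw; infer_instance

theorem lintegral_dataLaw_prod {n : ℕ} (θ : Fin n → ℝ) (f : Fin n → ℝ → ℝ≥0∞)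
    (hf : ∀ i, Measurable (f i)) :
    ∫⁻ X, ∏ i, f i (X i) ∂dataLaw θ = ∏ i, ∫⁻ x, f i x ∂gaussianReal (θ i) 1 := by
  have h := lintegral_prod_eq_prod_lintegral_of_indepFun (μ := dataLaw θ) Finset.univ
    (fun i X => f i (X i)) (iIndepFun_pi fun i => (hf i).aemeasurable)
    fun i => (hf i).comp (measurable_pi_apply i)
  rw [h]
  refine Finset.prod_congr rfl fun i _ => ?_
  exact (measurePreserving_eval (fun i => gaussianReal (θ i) 1) i).lintegral_comp (hf i)

theorem lintegral_dataLaw_eval {n : ℕ} (θ : Fin n → ℝ) (i : Fin n) {f : ℝ → ℝ≥0∞}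
    (hf : Measurable f) :
    ∫⁻ X, f (X i) ∂dataLaw θ = ∫⁻ x, f x ∂gaussianReal (θ i) 1 :=
  (measurePreserving_eval (fun i => gaussianReal (θ i) 1) i).lintegral_comp hf

/-- The product is exp(α·score/2), so it dominates the indicator of the event. -/
theorem one_le_prod_exp_tilt {n : ℕ} {X : Fin n → ℝ} {α : ℝ} (h0 : 0 < α)
    (h : 0 ≤ score X α) : 1 ≤ ∏ j, ENNReal.ofReal (Real.exp (tilt α (X j))) := by
  rw [← ENNReal.ofReal_prod_of_nonneg fun _ _ => (Real.exp_pos _).le, ← Real.exp_sum,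
    ENNReal.one_le_ofReal, Real.one_le_exp_iff]
  have : ∑ j, tilt α (X j) = 1 / 2 * α * score X α := by
    rw [score, Finset.mul_sum]
    exact Finset.sum_congr rfl fun i _ => by rw [tilt]; ring
  rw [this]
  positivity

/-- The noise terms integrated over the event that the score is nonnegative. -/
theorem lintegral_noise_mul_prod_le {n : ℕ} (θ : Fin n → ℝ) (T : Finset (Fin n))
    (hT : ∀ i, i ∉ T → θ i = 0) {α z : ℝ} (h0 : 0 < α) (h1 : α ≤ 1 / 4) (hz : 1 ≤ z)
    (hαz : 2304 * Real.exp (-z ^ 2 / 4) ≤ α) {i : Fin n} (hi : i ∉ T) :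
    ∫⁻ X, ENNReal.ofReal (1 + X i ^ 2) * ∏ j, ENNReal.ofReal (Real.exp (tilt α (X j)))
        ∂dataLaw θ ≤
      ENNReal.ofReal (4 * Real.exp (T.card / 2 - α / (1728 * z) * (n - T.card - 1))) := by
  have hα1 : α ≤ 1 := by linarith
  have hδ : 0 ≤ α / (1728 * z) := by positivity
  set δ := α / (1728 * z) with hδdef
  have hm := measurable_tilt α
  let f : Fin n → ℝ → ℝ≥0∞ := fun j x =>
    ENNReal.ofReal ((if j = i then 1 + x ^ 2 else 1) * Real.exp (tilt α x))
  have hf : ∀ j, Measurable (f j) := fun j => by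
    by_cases hj : j = i
    · simp only [f, hj, if_true]; fun_prop
    · simp only [f, hj, if_false]; fun_prop
  have e : ∀ X : Fin n → ℝ, ENNReal.ofReal (1 + X i ^ 2) *
      ∏ j, ENNReal.ofReal (Real.exp (tilt α (X j))) = ∏ j, f j (X j) := fun X => by
    have : ∀ j, f j (X j) = (if j = i then ENNReal.ofReal (1 + X i ^ 2) else 1) *
        ENNReal.ofReal (Real.exp (tilt α (X j))) := fun j => by
      by_cases hj : j = i
      · simp only [f, hj, if_true]
        rw [ENNReal.ofReal_mul (by positivity)]
      · simp only [f, hj, if_false, one_mul]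
    simp only [this]
    rw [Finset.prod_mul_distrib, Finset.prod_ite_eq' Finset.univ i, if_pos (Finset.mem_univ i)]
  simp only [e]
  rw [lintegral_dataLaw_prod θ f hf]
  -- Every coordinate is given the noise factor e^{-δ}; coordinate i and the signals are repaid by
  -- e^δ. A signal enters only through tilt ≤ 1/2, whatever its size.
  have hb : ∀ j, ∫⁻ x, f j x ∂gaussianReal (θ j) 1 ≤
      ENNReal.ofReal (((if j = i then 4 * Real.exp δ else 1) *
        (if j ∈ T then Real.exp (1 / 2 + δ) else 1)) * Real.exp (-δ)) := fun j => by
    by_cases hj : j = i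
    · subst hj
      simp only [f, if_true, if_neg hi, mul_one]
      rw [hT j hi, mul_assoc, ← Real.exp_add, add_neg_cancel, Real.exp_zero, mul_one]
      exact lintegral_sq_mul_exp_tilt_le h0 hα1
    by_cases hjT : j ∈ T
    · simp only [f, if_neg hj, if_pos hjT, one_mul]
      rw [← Real.exp_add, add_neg_cancel_right]
      calc _ ≤ ∫⁻ _, ENNReal.ofReal (Real.exp (1 / 2)) ∂gaussianReal (θ j) 1 :=
            lintegral_mono fun x => ENNReal.ofReal_le_ofReal
              (Real.exp_le_exp.2 (tilt_le h0 hα1 x))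
        _ = _ := by rw [lintegral_const, measure_univ, mul_one]
    · simp only [f, if_neg hj, if_neg hjT, one_mul]
      rw [hT j hjT]
      exact lintegral_exp_tilt_le h0 h1 hz hαz
  calc _ ≤ ∏ j, ENNReal.ofReal (((if j = i then 4 * Real.exp δ else 1) *
        (if j ∈ T then Real.exp (1 / 2 + δ) else 1)) * Real.exp (-δ)) :=
        Finset.prod_le_prod' fun j _ => hb j
    _ = _ := by
      rw [← ENNReal.ofReal_prod_of_nonneg fun j _ => by positivity]
      congr 1
      rw [Finset.prod_mul_distrib, Finset.prod_mul_distrib, Finset.prod_ite_eq' Finset.univ i,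
        if_pos (Finset.mem_univ i), Finset.prod_ite_mem, Finset.univ_inter, Finset.prod_const,
        Finset.prod_const, Finset.card_univ, Fintype.card_fin, ← Real.exp_nat_mul,
        ← Real.exp_nat_mul, mul_assoc 4, mul_assoc 4, ← Real.exp_add, ← Real.exp_add]
      ring_nf

/-! ### Large-sample estimates for the weights -/

/-- The sample size is so large that powers of its logarithm are dominated as needed. -/
structure LargeSample (A : ℝ) (n : ℕ) : Prop where
  pos : 0 < n
  log_ge : 200000 ≤ Real.log n
  log_log_le : 5 * Real.log (Real.log n) ≤ Real.log n
  log_pow_le_rpow : 864 * (3 + 2 * A) * Real.log n ^ 4 ≤ Real.exp (A * Real.log n)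
  log_pow_le_sqrt : (9 + 4 * A) * Real.log n ^ 5 ≤ Real.exp (1 / 2 * Real.log n)
  log_pow_le_self : 10 ^ 10 * Real.log n ^ 3 ≤ Real.exp (1 * Real.log n)

theorem eventually_mul_pow_le_exp (c : ℝ) (k : ℕ) {b : ℝ} (hb : 0 < b) :
    ∀ᶠ x : ℝ in Filter.atTop, c * x ^ k ≤ Real.exp (b * x) := by
  have h := (isLittleO_pow_exp_pos_mul_atTop k hb).def (c := 1 / (|c| + 1)) (by positivity)
  filter_upwards [h, Filter.eventually_ge_atTop 0] with x hx h0
  rw [Real.norm_of_nonneg (by positivity), Real.norm_of_nonneg (Real.exp_pos _).le,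
    one_div_mul_eq_div, le_div_iff₀ (by positivity)] at hx
  have : c * x ^ k ≤ (|c| + 1) * x ^ k := by
    gcongr
    linarith [le_abs_self c]
  linarith

theorem exists_largeSample {A : ℝ} (hA : 0 < A) :
    ∃ N : ℕ, 0 < N ∧ ∀ n : ℕ, N ≤ n → LargeSample A n := by
  have hlog : ∀ᶠ x : ℝ in Filter.atTop, 5 * Real.log x ≤ x := by
    have h := Real.isLittleO_log_id_atTop.def (c := 1 / 5) (by norm_num)
    filter_upwards [h, Filter.eventually_ge_atTop 1] with x hx h1
    rw [Real.norm_of_nonneg (Real.log_nonneg h1), id, Real.norm_of_nonneg (by linarith)] at hx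
    linarith
  have ht : Filter.Tendsto (fun n : ℕ => Real.log n) Filter.atTop Filter.atTop :=
    Real.tendsto_log_atTop.comp tendsto_natCast_atTop_atTop
  have h := (((Filter.eventually_ge_atTop 200000).and hlog).and
    ((eventually_mul_pow_le_exp (864 * (3 + 2 * A)) 4 hA).and
    ((eventually_mul_pow_le_exp (9 + 4 * A) 5 (b := 1 / 2) (by norm_num)).and
    (eventually_mul_pow_le_exp (10 ^ 10) 3 one_pos))))
  obtain ⟨N, hN⟩ := Filter.eventually_atTop.1 ((ht.eventually h).and
    (Filter.eventually_gt_atTop 0))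
  refine ⟨N + 1, by omega, fun n hn => ?_⟩
  obtain ⟨⟨⟨h1, h2⟩, h3, h4, h5⟩, h6⟩ := hN n (by omega)
  exact ⟨h6, h1, h2, h3, h4, h5⟩

namespace LargeSample

variable {A : ℝ} {n : ℕ}

theorem cast_pos (h : LargeSample A n) : (0 : ℝ) < n := Nat.cast_pos.2 h.pos

theorem exp_log (h : LargeSample A n) : Real.exp (Real.log n) = n := Real.exp_log h.cast_pos

theorem sqrt_log_le (h : LargeSample A n) :
    1 ≤ √(Real.log n) ∧ √(Real.log n) ≤ Real.log n ∧ √(Real.log n) ^ 2 = Real.log n := by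
  have hL := h.log_ge
  have hsq : √(Real.log n) ^ 2 = Real.log n := Real.sq_sqrt (by linarith)
  have h1 : 1 ≤ √(Real.log n) := Real.one_le_sqrt.2 (by linarith)
  exact ⟨h1, by nlinarith, hsq⟩

theorem log_sq_le (h : LargeSample A n) : Real.log n ^ 2 ≤ 1 / 10 ^ 10 * n := by
  have h1 := h.log_pow_le_self
  rw [one_mul, h.exp_log] at h1
  have hL := h.log_ge
  have : Real.log n ^ 2 ≤ Real.log n ^ 3 := pow_le_pow_right₀ (by linarith) (by norm_num)
  linarith

theorem alphaMin_le (h : LargeSample A n) :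
    alphaMin n = weightOf √(2 * Real.log n) ∧
      alphaMin n ≤ 54 * (1 + 2 * Real.log n) / n := by
  have hL := h.log_ge
  have e : alphaMin n = weightOf √(2 * Real.log n) := thresholdInv_eq_weightOf (Real.sqrt_nonneg _)
  refine ⟨e, e.trans_le ?_⟩
  refine (weightOf_le (Real.one_le_sqrt.2 (by linarith))).trans (le_of_eq ?_)
  rw [Real.sq_sqrt (by linarith), neg_div, mul_div_cancel_left₀ _ two_ne_zero, Real.exp_neg,
    h.exp_log]
  rfl

theorem threshold_sq (h : LargeSample A n) :
    √(2 * Real.log n - 5 * Real.log (Real.log n)) ^ 2 =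
      2 * Real.log n - 5 * Real.log (Real.log n) :=
  Real.sq_sqrt (by linarith [h.log_ge, h.log_log_le])

theorem exp_threshold_sq (h : LargeSample A n) :
    Real.exp (√(2 * Real.log n - 5 * Real.log (Real.log n)) ^ 2 / 2) =
      n / √(Real.log n) ^ 5 := by
  have hL := h.log_ge
  have e : Real.log (Real.log n) = 2 * Real.log √(Real.log n) := by
    rw [Real.log_sqrt (by linarith)]; ring
  have hx := h.sqrt_log_le.1
  rw [h.threshold_sq, e, show (2 * Real.log n - 5 * (2 * Real.log √(Real.log n))) / 2 =
    Real.log n - (5 : ℕ) * Real.log √(Real.log n) by push_cast; ring, Real.exp_sub, h.exp_log,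
    Real.exp_nat_mul, Real.exp_log (by linarith)]

/-- Subtracting 5 log log n from the squared threshold gains a factor log^{5/2} n, and the factor 1
+ t² of the Cauchy tail gains another log n, which beats the constant. -/
theorem lt_weightOf_threshold (h : LargeSample A n) :
    2 * 6912 * √(Real.log n) ^ 5 / n <
      weightOf √(2 * Real.log n - 5 * Real.log (Real.log n)) := by
  have hL := h.log_ge
  have hn := h.cast_pos
  obtain ⟨h1, h2, h3⟩ := h.sqrt_log_le
  refine lt_of_lt_of_le ?_ (le_weightOf (Real.sqrt_nonneg _))
  rw [h.exp_threshold_sq]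
  have ht : √(Real.log n) ^ 2 ≤ 1 + √(2 * Real.log n - 5 * Real.log (Real.log n)) ^ 2 := by
    rw [h.threshold_sq, h3]; linarith [h.log_log_le]
  have hself := h.log_pow_le_self
  rw [one_mul, h.exp_log] at hself
  set x := √(Real.log n)
  have hx0 : 0 < x := by linarith
  have h4 : 6 * (n / x ^ 5) / (1 + √(2 * Real.log n - 5 * Real.log (Real.log n)) ^ 2) ≤
      6 * (n / x ^ 5) / x ^ 2 := by gcongr
  rw [div_lt_div_iff₀ hn (by positivity), one_mul]
  have h5 : x ^ 5 ≤ Real.log n ^ 3 := by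
    rw [← h3, ← pow_mul]; exact pow_le_pow_right₀ h1 (by norm_num)
  calc _ ≤ 2 * 6912 * x ^ 5 * (1 + 6 * (n / x ^ 5) / x ^ 2) := by gcongr
    _ = 13824 * x ^ 5 + 82944 * n / x ^ 2 := by field_simp; ring
    _ ≤ 13824 * x ^ 5 + n / 2 := by
        -- Here 82944 = 6 · 13824, so log n ≥ 165888 is needed; this is covered by the 200000 in
        -- `LargeSample`.
        have : 82944 * n / x ^ 2 ≤ n / 2 := by
          rw [h3, div_le_div_iff₀ (by linarith) two_pos]
          nlinarith
        linarith
    _ < n := by linarith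

theorem weightOf_threshold_le (h : LargeSample A n) :
    weightOf √(2 * Real.log n - 5 * Real.log (Real.log n)) ≤
      162 * (Real.log n * √(Real.log n) ^ 5) / n := by
  have hL := h.log_ge
  have hl : 0 ≤ Real.log (Real.log n) := Real.log_nonneg (by linarith)
  refine (weightOf_le (Real.one_le_sqrt.2 (by linarith [h.log_log_le]))).trans ?_
  rw [neg_div, Real.exp_neg, h.exp_threshold_sq, inv_div, h.threshold_sq, ← mul_div_assoc]
  have hn := h.cast_pos
  have hll := h.log_log_le
  gcongr ?_ / _
  rw [← mul_assoc]
  exact mul_le_mul_of_nonneg_right (by linarith) (by positivity)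

theorem thresholdInv_modify (A : ℝ) (n : ℕ) : thresholdInv √(2 * (1 + A) * Real.log n) =
    weightOf √(2 * (1 + A) * Real.log n) := thresholdInv_eq_weightOf (Real.sqrt_nonneg _)

/-- This uses A > 0: the factor n^{-A} beats every power of log n. -/
theorem modified_weight_le (h : LargeSample A n) (hA : 0 < A) :
    16 * weightOf √(2 * (1 + A) * Real.log n) * √(Real.log n) ≤ 1 / n := by
  have hL := h.log_ge
  have hn := h.cast_pos
  obtain ⟨h1, h2, h3⟩ := h.sqrt_log_le
  have hw := weightOf_le (t := √(2 * (1 + A) * Real.log n))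
    (Real.one_le_sqrt.2 (by nlinarith))
  rw [Real.sq_sqrt (by nlinarith), neg_div, show 2 * (1 + A) * Real.log n / 2 =
    Real.log n + A * Real.log n by ring, Real.exp_neg, Real.exp_add, h.exp_log] at hw
  have hr := h.log_pow_le_rpow
  set L := Real.log n
  have h4 : 864 * (1 + 2 * (1 + A) * L) * √L ≤ Real.exp (A * L) := by
    have h24 : L ^ 2 ≤ L ^ 4 := pow_le_pow_right₀ (by linarith) (by norm_num)
    calc 864 * (1 + 2 * (1 + A) * L) * √L ≤ 864 * ((3 + 2 * A) * L) * L := by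
          gcongr
          nlinarith
      _ = 864 * (3 + 2 * A) * L ^ 2 := by ring
      _ ≤ 864 * (3 + 2 * A) * L ^ 4 := by gcongr
      _ ≤ _ := hr
  calc 16 * weightOf √(2 * (1 + A) * L) * √L
      ≤ 16 * (54 * (1 + 2 * (1 + A) * L) * (n * Real.exp (A * L))⁻¹) * √L := by gcongr
    _ = (864 * (1 + 2 * (1 + A) * L) * √L) / Real.exp (A * L) / n := by
        field_simp; ring
    _ ≤ 1 / n := by
        gcongr
        rw [div_le_one (Real.exp_pos _)]
        exact h4

/-- The exponential on the left is n^{-2-A}, a factor n below the order n^{-1-A} of the modified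
weight, logarithms aside. -/
theorem exp_le_modified_weight (h : LargeSample A n) (hA : 0 < A) :
    1152 * Real.exp (-(4 * (2 + A) * Real.log n) / 4) ≤
      weightOf √(2 * (1 + A) * Real.log n) := by
  have hL := h.log_ge
  refine le_trans ?_ (le_weightOf (Real.sqrt_nonneg _))
  rw [Real.sq_sqrt (by nlinarith), show 2 * (1 + A) * Real.log n / 2 = (1 + A) * Real.log n by ring]
  have hE : 1 ≤ Real.exp ((1 + A) * Real.log n) := Real.one_le_exp (by nlinarith)
  have e : Real.exp (-(4 * (2 + A) * Real.log n) / 4) =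
      (Real.exp (Real.log n) * Real.exp ((1 + A) * Real.log n))⁻¹ := by
    rw [← Real.exp_add, ← Real.exp_neg]; ring_nf
  have h8 := Real.add_one_le_exp (Real.log n)
  rw [e]
  set L := Real.log n
  set E := Real.exp ((1 + A) * L)
  have h6 : 6 * E / (1 + 2 * (1 + A) * L) ≤ 6 * E := div_le_self (by positivity) (by nlinarith)
  rw [le_div_iff₀ (by positivity)]
  calc _ ≤ 1152 * (Real.exp L * E)⁻¹ * (1 + 6 * E) := by gcongr
    _ ≤ 1152 * (Real.exp L * E)⁻¹ * (7 * E) := by gcongr; linarith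
    _ = 8064 / Real.exp L := by field_simp; norm_num
    _ ≤ 1 := by rw [div_le_one (Real.exp_pos _)]; linarith

/-- Small weights in the modified regime, when the sparsity exceeds `√n`. -/
theorem mul_weightOf_threshold_le (h : LargeSample A n) (hA : 0 < A) {s : ℝ}
    (hs : √(n : ℝ) ≤ s) :
    (4 * (2 + A) * Real.log n + 1) *
      weightOf √(2 * Real.log n - 5 * Real.log (Real.log n)) ≤ 1152 * (s / n) := by
  have hL := h.log_ge
  have hn := h.cast_pos
  obtain ⟨h1, h2, h3⟩ := h.sqrt_log_le
  have hw := h.weightOf_threshold_le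
  have hw0 := (weightOf_mem (Real.sqrt_nonneg (2 * Real.log n - 5 * Real.log (Real.log n)))).1.le
  have hq := h.log_pow_le_sqrt
  have e : Real.exp (1 / 2 * Real.log n) = √(n : ℝ) := by
    rw [← h.exp_log, ← Real.exp_half, Real.log_exp]; ring_nf
  rw [e] at hq
  set L := Real.log n
  have h5 : √L ^ 5 ≤ L ^ 3 := by
    rw [← h3, ← pow_mul, h3]; exact pow_le_pow_right₀ h1 (by norm_num)
  calc _ ≤ ((9 + 4 * A) * L) * (162 * (L * √L ^ 5) / n) := by
        gcongr
        nlinarith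
    _ ≤ ((9 + 4 * A) * L) * (162 * (L * L ^ 3) / n) := by gcongr
    _ = 162 * ((9 + 4 * A) * L ^ 5) / n := by ring
    _ ≤ 1152 * s / n := by
        gcongr ?_ / _
        nlinarith [Real.sqrt_nonneg (n : ℝ)]
    _ = _ := by ring

end LargeSample

/-! ### Upper level for the estimated weight -/

/-- The level below which the estimate of the weight stays with high probability, when at most
`σ` coefficients are nonzero. -/
noncomputable def upperWeight (n : ℕ) (σ : ℝ) : ℝ := 6912 * (σ / n) * (2 * √(Real.log (n / σ)))

theorem upperWeight_spec {A σ : ℝ} {n : ℕ} (h : LargeSample A n) (h1 : Real.log n ^ 2 ≤ σ)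
    (h2 : σ ≤ 1 / 10 ^ 10 * n) :
    0 < upperWeight n σ ∧ upperWeight n σ ≤ 1 / 4 ∧ 1 ≤ 2 * √(Real.log (n / σ)) ∧
      Real.exp (-(2 * √(Real.log (n / σ))) ^ 2 / 4) = σ / n ∧
      2304 * Real.exp (-(2 * √(Real.log (n / σ))) ^ 2 / 4) ≤ upperWeight n σ ∧
      alphaMin n ≤ upperWeight n σ := by
  have hL := h.log_ge
  have hn := h.cast_pos
  have hσ : 0 < σ := lt_of_lt_of_le (by positivity) h1
  have hy : 10 ^ 10 ≤ n / σ := by rw [le_div_iff₀ hσ]; linarith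
  have hly : 1 ≤ Real.log (n / σ) := by
    rw [Real.le_log_iff_exp_le (by linarith)]
    linarith [Real.exp_one_lt_d9]
  have hz : 1 ≤ √(Real.log (n / σ)) := Real.one_le_sqrt.2 hly
  have hexp : Real.exp (-(2 * √(Real.log (n / σ))) ^ 2 / 4) = σ / n := by
    rw [← exp_neg_log_div hn hσ, mul_pow, Real.sq_sqrt (by linarith)]
    ring_nf
  have hr : 0 < σ / n := by positivity
  refine ⟨by unfold upperWeight; positivity, ?_, by linarith, hexp, ?_, ?_⟩
  · have h3 : √(Real.log (n / σ)) ≤ √(n / σ) :=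
      Real.sqrt_le_sqrt ((Real.log_le_sub_one_of_pos (by linarith)).trans (by linarith))
    -- The sparsity constant 10^{-10} enters here: 10^5 exceeds 4 · 13824, which puts the level
    -- below 1/4.
    have h4 : 10 ^ 5 ≤ √(n / σ) := Real.le_sqrt_of_sq_le (by norm_num at hy ⊢; exact hy)
    have h5 : √(n / σ) ^ 2 = n / σ := Real.sq_sqrt (by linarith)
    have h6 : σ / n * (n / σ) = 1 := by field_simp
    unfold upperWeight
    calc _ ≤ 6912 * (σ / n) * (2 * √(n / σ)) := by gcongr
      _ = σ / n * (13824 * √(n / σ)) := by ring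
      _ ≤ σ / n * (1 / 4 * (n / σ)) := by
          have : 13824 * √(n / σ) ≤ 1 / 4 * (n / σ) := by nlinarith
          exact mul_le_mul_of_nonneg_left this hr.le
      _ = _ := by rw [mul_left_comm, h6, mul_one]
  · rw [hexp, upperWeight]
    nlinarith
  · refine h.alphaMin_le.2.trans ?_
    rw [upperWeight]
    calc 54 * (1 + 2 * Real.log n) / n ≤ 6912 * Real.log n ^ 2 / n := by
          have : 54 * (1 + 2 * Real.log n) ≤ 6912 * Real.log n ^ 2 := by nlinarith
          gcongr ?_ / _
      _ ≤ 6912 * σ / n * (2 * 1) := by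
          rw [mul_comm _ (2 * 1 : ℝ)]
          have : 6912 * Real.log n ^ 2 / n ≤ 6912 * σ / n := by gcongr
          have : 0 ≤ 6912 * σ / n := by positivity
          linarith
      _ ≤ 6912 * σ / n * (2 * √(Real.log (n / σ))) := by gcongr
      _ = _ := by ring

/-- The level at σ = log² n is at most of order log^{5/2} n / n. For sparser vectors, an estimate
below this level therefore triggers the modification. -/
theorem upperWeight_log_sq_lt {A : ℝ} {n : ℕ} (h : LargeSample A n) :
    upperWeight n (Real.log n ^ 2) <
      weightOf √(2 * Real.log n - 5 * Real.log (Real.log n)) := by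
  have hL := h.log_ge
  have hn := h.cast_pos
  obtain ⟨h1, h2, h3⟩ := h.sqrt_log_le
  refine lt_of_le_of_lt ?_ h.lt_weightOf_threshold
  have h4 : √(Real.log (n / Real.log n ^ 2)) ≤ √(Real.log n) := by
    apply Real.sqrt_le_sqrt
    apply Real.log_le_log (by positivity)
    exact div_le_self hn.le (one_le_pow₀ (by linarith))
  have e : Real.log n ^ 2 = √(Real.log n) ^ 4 := by rw [← h3]; ring_nf; rw [h3]
  unfold upperWeight
  calc _ ≤ 6912 * (Real.log n ^ 2 / n) * (2 * √(Real.log n)) := by gcongr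
    _ = _ := by rw [e]; ring

/-! ### Pointwise bounds for the modified estimator -/

theorem modify_cases {A : ℝ} {n : ℕ} {a : ℝ} (h0 : 0 < a) (h1 : a ≤ 1) :
    (weightOf √(2 * Real.log n - 5 * Real.log (Real.log n)) ≤ a ∧ modify A n a = a) ∨
    (a < weightOf √(2 * Real.log n - 5 * Real.log (Real.log n)) ∧
      modify A n a = weightOf √(2 * (1 + A) * Real.log n)) := by
  have ht := threshold_le_iff h0 h1 (Real.sqrt_nonneg (2 * Real.log n - 5 * Real.log (Real.log n)))
  by_cases h : threshold a ≤ √(2 * Real.log n - 5 * Real.log (Real.log n))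
  · exact Or.inl ⟨ht.1 h, by rw [modify, if_pos h]⟩
  · refine Or.inr ⟨not_le.1 (mt ht.2 h), ?_⟩
    rw [modify, if_neg h, LargeSample.thresholdInv_modify]

theorem IsMMLE.pos {n : ℕ} {X : Fin n → ℝ} {a : ℝ} (ha : IsMMLE X a) : 0 < alphaMin n ∧ 0 < a := by
  have : 0 < alphaMin n := by
    rw [alphaMin, thresholdInv_eq_weightOf (Real.sqrt_nonneg _)]
    exact (weightOf_mem (Real.sqrt_nonneg _)).1
  exact ⟨this, this.trans_le ha.1.1⟩

theorem modify_mem {A : ℝ} {n : ℕ} {a : ℝ} (h0 : 0 < a) (h1 : a ≤ 1) :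
    0 < modify A n a ∧ modify A n a ≤ 1 := by
  rcases modify_cases (A := A) (n := n) h0 h1 with ⟨-, h⟩ | ⟨-, h⟩ <;> rw [h]
  · exact ⟨h0, h1⟩
  · exact weightOf_mem (Real.sqrt_nonneg _)

/-- The signals that are shrunk cost no more than the minimax rate, whatever the data. -/
theorem sum_one_sub_weight_mul_sq_le {A : ℝ} (hA : 0 < A) {n : ℕ} (h : LargeSample A n)
    {s : ℝ} (hs1 : 1 ≤ s) (hsn : s ≤ 1 / 10 ^ 10 * n) (hl : 1 ≤ Real.log (n / s))
    {T : Finset (Fin n)} (hT : (T.card : ℝ) ≤ s) {X : Fin n → ℝ} {a : ℝ} (ha : IsMMLE X a) :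
    ∑ i ∈ T, (1 - weight (modify A n a) (X i)) * X i ^ 2 ≤
      (2400 + 8 * A) * (s * Real.log (n / s)) := by
  obtain ⟨hmin, ha0⟩ := ha.pos
  have ha1 := ha.1.2
  have hn := h.cast_pos
  have hL := h.log_ge
  have hsum := sum_g_div_den_le hmin ha.1 ha.2
  have hs0 : 0 < s := by linarith
  have hsn' : s ≤ n := by linarith
  have hsl : s ≤ s * Real.log (n / s) := le_mul_of_one_le_right hs0.le hl
  have hAsl : 0 ≤ A * (s * Real.log (n / s)) := by positivity
  have key : ∀ c : ℝ, 0 ≤ c →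
      (∀ i ∈ T, (1 - weight (modify A n a) (X i)) * X i ^ 2 ≤
        4 * Real.log (n / s) + c * (s / n) * (g (X i) / den a (X i))) →
      ∑ i ∈ T, (1 - weight (modify A n a) (X i)) * X i ^ 2 ≤
        4 * (s * Real.log (n / s)) + c * s := fun c hc hi => by
    calc _ ≤ ∑ i ∈ T, (4 * Real.log (n / s) + c * (s / n) * (g (X i) / den a (X i))) :=
          Finset.sum_le_sum hi
      _ = T.card * (4 * Real.log (n / s)) + c * (s / n) * ∑ i ∈ T, g (X i) / den a (X i) := by
          rw [Finset.sum_add_distrib, Finset.sum_const, nsmul_eq_mul, Finset.mul_sum]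
      _ ≤ s * (4 * Real.log (n / s)) + c * (s / n) * n := by
          gcongr
          refine (Finset.sum_le_sum_of_subset_of_nonneg (Finset.subset_univ T) fun i _ _ => ?_).trans
            hsum
          exact g_div_den_nonneg ha0 ha1 _
      _ = _ := by field_simp
  rcases modify_cases (A := A) (n := n) ha0 ha1 with ⟨hle, hm⟩ | ⟨hlt, hm⟩
  · have := key 1152 (by norm_num) fun i _ => by
      rw [hm]; exact one_sub_weight_mul_sq_le_log_add ha0 ha1 hs0 hsn' _
    linarith
  · obtain ⟨hw0, hw1⟩ := weightOf_mem (Real.sqrt_nonneg (2 * (1 + A) * Real.log n))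
    have hB := h.exp_le_modified_weight hA
    have hB0 : 0 ≤ 4 * (2 + A) * Real.log n := by positivity
    -- Above √n the replaced estimate, polylogarithmic over n, is small against s/n; below √n, log n
    -- is at most 2 log(n/s), so a bound of order log n per signal is enough.
    rcases le_total (√(n : ℝ)) s with hsq | hsq
    · have := key 2304 (by norm_num) fun i _ => by
        rw [hm]
        refine one_sub_weight_mul_sq_le_of_small hw0 hw1 hB hB0 ha0 ha1 hs0 hsn' ?_ _
        refine le_trans ?_ (h.mul_weightOf_threshold_le hA hsq)
        gcongr
      linarith
    · have hlog : Real.log n ≤ 2 * Real.log (n / s) := by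
        have h1 : √(n : ℝ) ≤ n / s := by
          rw [le_div_iff₀ hs0]
          calc √(n : ℝ) * s ≤ √(n : ℝ) * √(n : ℝ) := by gcongr
            _ = n := Real.mul_self_sqrt hn.le
        have h2 := Real.log_le_log (Real.sqrt_pos.2 hn) h1
        rw [Real.log_sqrt hn.le] at h2
        linarith
      calc _ ≤ ∑ _i ∈ T, (4 * (2 + A) * Real.log n + 1) := Finset.sum_le_sum fun i _ => by
            rw [hm]; exact one_sub_weight_mul_sq_le_of_exp_le hw0 hw1 hB hB0 _
        _ = T.card * (4 * (2 + A) * Real.log n + 1) := by rw [Finset.sum_const, nsmul_eq_mul]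
        _ ≤ s * (4 * (2 + A) * (2 * Real.log (n / s)) + 1) := by gcongr
        _ = (16 + 8 * A) * (s * Real.log (n / s)) + s := by ring
        _ ≤ _ := by linarith

/-- The deterministic weight that dominates the estimated one on the good event. -/
noncomputable def noiseWeight (A : ℝ) (n : ℕ) (s : ℝ) : ℝ :=
  open scoped Classical in
  -- The second branch is a filler: for s < log² n the good event excludes an unmodified estimate,
  -- so any weight with small noise risk would do.
  if Real.log n ^ 2 ≤ s then upperWeight n s else weightOf √(2 * (1 + A) * Real.log n)

/-- One summand per case: the modification acts; the unmodified estimate is below the upper level;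
it is above, so the score is nonnegative and the product is at least 1. The estimator is absent from
the right-hand side. -/
theorem weight_modify_le {A : ℝ} {n : ℕ} (h : LargeSample A n)
    {s : ℝ} (hsn : s ≤ 1 / 10 ^ 10 * n) {X : Fin n → ℝ} {a : ℝ} (ha : IsMMLE X a) (x : ℝ) :
    ENNReal.ofReal ((1 + x ^ 2) * weight (modify A n a) x) ≤
      ENNReal.ofReal ((1 + x ^ 2) * weight (weightOf √(2 * (1 + A) * Real.log n)) x) +
      ENNReal.ofReal ((1 + x ^ 2) * weight (noiseWeight A n s) x) +
      ENNReal.ofReal (1 + x ^ 2) * ∏ j, ENNReal.ofReal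
        (Real.exp (tilt (upperWeight n (max s (Real.log n ^ 2))) (X j))) := by
  obtain ⟨hmin, ha0⟩ := ha.pos
  have ha1 := ha.1.2
  rcases modify_cases (A := A) (n := n) ha0 ha1 with ⟨hle, hm⟩ | ⟨-, hm⟩
  swap
  · rw [hm, add_assoc]; exact le_self_add
  rw [hm]
  obtain ⟨hu0, hu1, -, -, -, hu⟩ := upperWeight_spec (σ := max s (Real.log n ^ 2)) h
    (le_max_right _ _) (max_le hsn h.log_sq_le)
  rcases le_or_gt a (upperWeight n (max s (Real.log n ^ 2))) with hau | hau
  · have hs : Real.log n ^ 2 ≤ s := by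
      by_contra hs
      rw [max_eq_right (not_le.1 hs).le] at hau
      linarith [upperWeight_log_sq_lt h]
    rw [max_eq_left hs] at hau hu1
    refine le_trans ?_ (le_self_add.trans' le_add_self)
    rw [noiseWeight, if_pos hs]
    gcongr
    exact weight_mono ha0 hau (by linarith) x
  · have hsc := score_nonneg_of_lt hmin ha.1 ha.2 hu hau
    have hp := one_le_prod_exp_tilt hu0 hsc
    refine le_trans ?_ le_add_self
    calc _ ≤ ENNReal.ofReal (1 + x ^ 2) * 1 := by
          rw [mul_one]
          apply ENNReal.ofReal_le_ofReal
          exact mul_le_of_le_one_right (by positivity) (weight_le_one ha0 ha1 x)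
      _ ≤ _ := by gcongr

theorem posteriorLoss_modify_le {A : ℝ} (hA : 0 < A) {n : ℕ} (h : LargeSample A n) {C : ℝ}
    (hC : 2 ≤ C) (hloss : ∀ (n : ℕ) (α : ℝ) (θ X : Fin n → ℝ),
      0 < α → α ≤ 1 → posteriorLoss α θ X ≤ ENNReal.ofReal (∑ i, ((1 - weight α (X i)) * θ i ^ 2 +
      weight α (X i) * (2 * (X i - θ i) ^ 2 + C))))
    {s : ℝ} (hs1 : 1 ≤ s) (hsn : s ≤ 1 / 10 ^ 10 * n) (hl : 1 ≤ Real.log (n / s))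
    {T : Finset (Fin n)} (hT : (T.card : ℝ) ≤ s) {θ : Fin n → ℝ} (hθ : ∀ i ∉ T, θ i = 0)
    {X : Fin n → ℝ} {a : ℝ} (ha : IsMMLE X a) :
    posteriorLoss (modify A n a) θ X ≤
      ENNReal.ofReal ((4800 + 16 * A + C) * (s * Real.log (n / s))) +
      ∑ i ∈ T, ENNReal.ofReal (4 * (X i - θ i) ^ 2) +
      ENNReal.ofReal C * ∑ i ∈ Tᶜ,
        (ENNReal.ofReal ((1 + X i ^ 2) * weight (weightOf √(2 * (1 + A) * Real.log n)) (X i)) +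
        ENNReal.ofReal ((1 + X i ^ 2) * weight (noiseWeight A n s) (X i)) +
        ENNReal.ofReal (1 + X i ^ 2) * ∏ j, ENNReal.ofReal
          (Real.exp (tilt (upperWeight n (max s (Real.log n ^ 2))) (X j)))) := by
  obtain ⟨hmin, ha0⟩ := ha.pos
  obtain ⟨hm0, hm1⟩ := modify_mem (A := A) (n := n) ha0 ha.1.2
  have hsig := sum_one_sub_weight_mul_sq_le hA h hs1 hsn hl hT ha
  have hs0 : 0 < s := by linarith
  have hsl : s ≤ s * Real.log (n / s) := le_mul_of_one_le_right hs0.le hl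
  refine (hloss n _ θ X hm0 hm1).trans ?_
  set α := modify A n a
  have hw : ∀ x, 0 ≤ weight α x := weight_nonneg hm0 hm1
  have hw' : ∀ x, 0 ≤ 1 - weight α x := fun x => sub_nonneg.2 (weight_le_one hm0 hm1 x)
  have hreal : ∑ i, ((1 - weight α (X i)) * θ i ^ 2 +
      weight α (X i) * (2 * (X i - θ i) ^ 2 + C)) ≤
      (4800 + 16 * A + C) * (s * Real.log (n / s)) + ∑ i ∈ T, 4 * (X i - θ i) ^ 2 +
        ∑ i ∈ Tᶜ, C * ((1 + X i ^ 2) * weight α (X i)) := by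
    rw [← Finset.sum_add_sum_compl T]
    refine add_le_add ?_ (Finset.sum_le_sum fun i hi => ?_)
    · calc _ ≤ ∑ i ∈ T, (2 * ((1 - weight α (X i)) * X i ^ 2) + 4 * (X i - θ i) ^ 2 + C) := by
            refine Finset.sum_le_sum fun i _ => ?_
            have h1 : θ i ^ 2 ≤ 2 * X i ^ 2 + 2 * (X i - θ i) ^ 2 := by
              nlinarith [sq_nonneg (2 * X i - θ i)]
            have h2 := mul_le_mul_of_nonneg_left h1 (hw' (X i))
            have h3 := mul_nonneg (hw' (X i)) (sq_nonneg (X i - θ i))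
            have h4 := mul_nonneg (hw (X i)) (sq_nonneg (X i - θ i))
            nlinarith [mul_nonneg (hw' (X i)) (by linarith : (0 : ℝ) ≤ C)]
        _ = 2 * ∑ i ∈ T, (1 - weight α (X i)) * X i ^ 2 + ∑ i ∈ T, 4 * (X i - θ i) ^ 2 +
              T.card * C := by
            rw [Finset.sum_add_distrib, Finset.sum_add_distrib, Finset.sum_const, nsmul_eq_mul,
              ← Finset.mul_sum]
        _ ≤ _ := by
            have : T.card * C ≤ s * Real.log (n / s) * C :=
              mul_le_mul_of_nonneg_right (hT.trans hsl) (by linarith)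
            linarith
    · rw [hθ i (Finset.mem_compl.1 hi)]
      have := mul_nonneg (hw (X i)) (sq_nonneg (X i))
      nlinarith
  refine (ENNReal.ofReal_le_ofReal hreal).trans ?_
  have hsl0 : 0 ≤ s * Real.log (n / s) := by linarith
  have hCn : 0 ≤ (4800 + 16 * A + C) * (s * Real.log (n / s)) := by positivity
  rw [ENNReal.ofReal_add (add_nonneg hCn (Finset.sum_nonneg fun i _ => by positivity))
      (Finset.sum_nonneg fun i _ => mul_nonneg (by linarith)
        (mul_nonneg (by positivity) (hw _))),
    ENNReal.ofReal_add hCn (Finset.sum_nonneg fun i _ => by positivity),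
    ENNReal.ofReal_sum_of_nonneg fun i _ => by positivity,
    ENNReal.ofReal_sum_of_nonneg fun i _ => mul_nonneg (by linarith)
        (mul_nonneg (by positivity) (hw _)), Finset.mul_sum]
  gcongr with i hi
  rw [ENNReal.ofReal_mul (by linarith)]
  gcongr
  exact weight_modify_le h hsn ha (X i)

/-! ### Expectations of the dominating terms -/

theorem lintegral_sq_sub_gaussianReal (m : ℝ) :
    ∫⁻ x, ENNReal.ofReal (4 * (x - m) ^ 2) ∂gaussianReal m 1 ≤ ENNReal.ofReal 4 := by
  have e := gaussianReal_map_add_const (μ := 0) (v := 1) m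
  rw [zero_add] at e
  rw [← e, lintegral_map (by fun_prop) (by fun_prop)]
  simp only [add_sub_cancel_right]
  refine lintegral_gaussianReal_le (h := fun x => 4 * (x ^ 2 * phi x))
    (fun x => le_of_eq (by ring)) (fun x => by positivity)
    (integrable_sq_mul_phi.const_mul _) ?_
  rw [integral_const_mul, integral_sq_mul_phi, mul_one]

theorem measurable_weight (α : ℝ) : Measurable (weight α) := by
  have h1 := continuous_phi.measurable
  have h2 := continuous_g.measurable
  unfold weight
  fun_prop

theorem lintegral_modified_noise_le {A : ℝ} (hA : 0 < A) {n : ℕ} (h : LargeSample A n) :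
    ∫⁻ x, ENNReal.ofReal ((1 + x ^ 2) * weight (weightOf √(2 * (1 + A) * Real.log n)) x)
      ∂gaussianReal 0 1 ≤ ENNReal.ofReal (25 / n) := by
  have hn := h.cast_pos
  have hL := h.log_ge
  obtain ⟨hw0, -⟩ := weightOf_mem (Real.sqrt_nonneg (2 * (1 + A) * Real.log n))
  obtain ⟨h1, -, h3⟩ := h.sqrt_log_le
  have hm := h.modified_weight_le hA
  have hn1 : 1 / (n : ℝ) ≤ 1 := by
    rw [div_le_one hn]; exact_mod_cast h.pos
  -- This z makes e^{-z²/4} = 1/n.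
  refine (lintegral_noise_le (z := 2 * √(Real.log n)) hw0 (by nlinarith) (by positivity)).trans
    (ENNReal.ofReal_le_ofReal ?_)
  have e : Real.exp (-(2 * √(Real.log n)) ^ 2 / 4) = 1 / n := by
    rw [mul_pow, h3, show -(2 ^ 2 * Real.log n) / 4 = -Real.log n by ring, Real.exp_neg, h.exp_log,
      one_div]
  rw [e]
  calc _ ≤ 1 / (n : ℝ) + 24 * (1 / n) := by linarith
    _ = _ := by ring

theorem lintegral_noiseWeight_le {A : ℝ} (hA : 0 < A) {n : ℕ} (h : LargeSample A n) {s : ℝ}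
    (hs1 : 1 ≤ s) (hsn : s ≤ 1 / 10 ^ 10 * n) (hl : 1 ≤ Real.log (n / s)) :
    ∫⁻ x, ENNReal.ofReal ((1 + x ^ 2) * weight (noiseWeight A n s) x) ∂gaussianReal 0 1 ≤
      ENNReal.ofReal (300000 * (s * Real.log (n / s)) / n) := by
  have hn := h.cast_pos
  have hs0 : 0 < s := by linarith
  have hsl : s ≤ s * Real.log (n / s) := le_mul_of_one_le_right hs0.le hl
  by_cases hs : Real.log n ^ 2 ≤ s
  · rw [noiseWeight, if_pos hs]
    obtain ⟨hu0, hu1, hz, hexp, -, -⟩ := upperWeight_spec h hs hsn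
    refine (lintegral_noise_le hu0 (by linarith) (by linarith : 0 ≤ 2 * √(Real.log (n / s)))).trans
      (ENNReal.ofReal_le_ofReal ?_)
    rw [hexp]
    have hsq : √(Real.log (n / s)) ^ 2 = Real.log (n / s) := Real.sq_sqrt (by linarith)
    have e : 8 * upperWeight n s * (2 * √(Real.log (n / s))) + 24 * (s / n) =
        (221184 * (s * √(Real.log (n / s)) ^ 2) + 24 * s) / n := by
      rw [upperWeight]; ring
    rw [e, hsq]
    gcongr
    linarith
  · rw [noiseWeight, if_neg hs]
    refine (lintegral_modified_noise_le hA h).trans (ENNReal.ofReal_le_ofReal ?_)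
    gcongr
    linarith

theorem lintegral_bad_event_le {A : ℝ} {n : ℕ} (h : LargeSample A n) {s : ℝ}
    (hsn : s ≤ 1 / 10 ^ 10 * n) {T : Finset (Fin n)} (hT : (T.card : ℝ) ≤ s) {θ : Fin n → ℝ}
    (hθ : ∀ i ∉ T, θ i = 0) {i : Fin n} (hi : i ∉ T) :
    ∫⁻ X, ENNReal.ofReal (1 + X i ^ 2) * ∏ j, ENNReal.ofReal
      (Real.exp (tilt (upperWeight n (max s (Real.log n ^ 2))) (X j))) ∂dataLaw θ ≤
      ENNReal.ofReal (4 / n) := by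
  have hn := h.cast_pos
  have hL := h.log_ge
  set σ := max s (Real.log n ^ 2)
  have hσn : σ ≤ 1 / 10 ^ 10 * n := max_le hsn h.log_sq_le
  have hσ : Real.log n ^ 2 ≤ σ := le_max_right _ _
  have hsσ : s ≤ σ := le_max_left _ _
  obtain ⟨hu0, hu1, hz, hexp, hgt, -⟩ := upperWeight_spec h hσ hσn
  refine (lintegral_noise_mul_prod_le θ T hθ hu0 hu1 hz hgt hi).trans
    (ENNReal.ofReal_le_ofReal ?_)
  -- With 6912 = 4 · 1728, the gain per noise coordinate is exactly 4σ/n.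
  have e : upperWeight n σ / (1728 * (2 * √(Real.log (n / σ)))) = 4 * (σ / n) := by
    have : 2 * √(Real.log (n / σ)) ≠ 0 := by linarith
    rw [upperWeight, mul_div_mul_right _ _ this]
    ring
  have hcard : (n : ℝ) / 2 ≤ n - T.card - 1 := by
    have : (200000 : ℝ) ≤ n := by
      have := h.exp_log ▸ Real.add_one_le_exp (Real.log n)
      linarith
    linarith
  have hσ0 : 0 < σ := lt_of_lt_of_le (by positivity) hσ
  have h5 : 4 * (σ / n) * (n / 2) ≤ 4 * (σ / n) * (n - T.card - 1) := by gcongr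
  have h6 : 4 * (σ / n) * (n / 2) = 2 * σ := by field_simp; norm_num
  -- The exponent is at most s/2 - 2σ ≤ -3σ/2, and σ ≥ log² n ≥ log n.
  have h7 : Real.exp (T.card / 2 - 4 * (σ / n) * (n - T.card - 1)) ≤ Real.exp (-Real.log n) :=
    Real.exp_le_exp.2 (by nlinarith)
  rw [e, div_eq_mul_inv 4 (n : ℝ)]
  rw [Real.exp_neg, h.exp_log] at h7
  gcongr

/-! ### Risk bound -/

theorem lintegral_posteriorLoss_modify_le {A : ℝ} (hA : 0 < A) {n : ℕ} (h : LargeSample A n)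
    {C : ℝ} (hC : 2 ≤ C) (hloss : ∀ (n : ℕ) (α : ℝ) (θ X : Fin n → ℝ),
      0 < α → α ≤ 1 → posteriorLoss α θ X ≤ ENNReal.ofReal (∑ i, ((1 - weight α (X i)) * θ i ^ 2 +
      weight α (X i) * (2 * (X i - θ i) ^ 2 + C))))
    {s : ℝ} (hs1 : 1 ≤ s) (hsn : s ≤ 1 / 10 ^ 10 * n)
    {θ : Fin n → ℝ} (hθ : θ ∈ sparse n s)
    {αhat : (Fin n → ℝ) → ℝ} (hα : ∀ X, IsMMLE X (αhat X)) :
    ∫⁻ X, posteriorLoss (modify A n (αhat X)) θ X ∂dataLaw θ ≤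
      ENNReal.ofReal ((2500 + 8 * A + 200000 * C) * rate n s) := by
  have hn := h.cast_pos
  have hs0 : 0 < s := by linarith
  have hl : 1 ≤ Real.log (n / s) := by
    have : 10 ^ 10 ≤ n / s := by rw [le_div_iff₀ hs0]; linarith
    rw [Real.le_log_iff_exp_le (by linarith)]
    linarith [Real.exp_one_lt_d9]
  have hsl : s ≤ s * Real.log (n / s) := le_mul_of_one_le_right hs0.le hl
  obtain ⟨T, hTdef⟩ : ∃ T : Finset (Fin n), (T : Set (Fin n)) = {i | θ i ≠ 0} :=
    ⟨(Set.toFinite _).toFinset, Set.Finite.coe_toFinset _⟩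
  have hT : (T.card : ℝ) ≤ s := by
    have : (({i | θ i ≠ 0} : Set (Fin n)).ncard : ℝ) ≤ s := hθ
    rwa [← hTdef, Set.ncard_coe_finset] at this
  have hT0 : ∀ i ∉ T, θ i = 0 := fun i hi => by
    by_contra h0
    have : i ∈ (T : Set (Fin n)) := by rw [hTdef]; exact h0
    exact hi this
  have hm1 := measurable_weight (weightOf √(2 * (1 + A) * Real.log n))
  have hm2 := measurable_weight (noiseWeight A n s)
  have hm3 := measurable_tilt (upperWeight n (max s (Real.log n ^ 2)))
  -- The estimator is eliminated before integrating, so its measurability plays no role.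
  refine (lintegral_mono fun X =>
    posteriorLoss_modify_le hA h hC hloss hs1 hsn hl hT hT0 (hα X)).trans ?_
  have hnoise : ∀ i ∈ Tᶜ, ∫⁻ X : Fin n → ℝ, (ENNReal.ofReal ((1 + X i ^ 2) *
          weight (weightOf √(2 * (1 + A) * Real.log n)) (X i)) +
        ENNReal.ofReal ((1 + X i ^ 2) * weight (noiseWeight A n s) (X i)) +
        ENNReal.ofReal (1 + X i ^ 2) * ∏ j, ENNReal.ofReal
          (Real.exp (tilt (upperWeight n (max s (Real.log n ^ 2))) (X j)))) ∂dataLaw θ ≤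
      ENNReal.ofReal (300030 * (s * Real.log (n / s)) / n) := fun i hi => by
    have hi := Finset.mem_compl.1 hi
    rw [lintegral_add_left (by fun_prop), lintegral_add_left (by fun_prop),
      lintegral_dataLaw_eval θ i (f := fun x => ENNReal.ofReal ((1 + x ^ 2) *
        weight (weightOf √(2 * (1 + A) * Real.log n)) x)) (by fun_prop),
      lintegral_dataLaw_eval θ i (f := fun x => ENNReal.ofReal ((1 + x ^ 2) *
        weight (noiseWeight A n s) x)) (by fun_prop), hT0 i hi]
    refine (add_le_add (add_le_add (lintegral_modified_noise_le hA h)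
      (lintegral_noiseWeight_le hA h hs1 hsn hl))
      (lintegral_bad_event_le h hsn hT hT0 hi)).trans ?_
    rw [← ENNReal.ofReal_add (by positivity) (by positivity),
      ← ENNReal.ofReal_add (by positivity) (by positivity)]
    apply ENNReal.ofReal_le_ofReal
    rw [← add_div, ← add_div]
    gcongr
    linarith
  rw [lintegral_add_left (by fun_prop), lintegral_add_left (by fun_prop), lintegral_const,
    measure_univ, mul_one, lintegral_finsetSum _ fun i _ => by fun_prop,
    lintegral_const_mul _ (by fun_prop), lintegral_finsetSum _ fun i _ => by fun_prop]
  calc _ ≤ ENNReal.ofReal ((4800 + 16 * A + C) * (s * Real.log (n / s))) +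
        ∑ _i ∈ T, ENNReal.ofReal 4 + ENNReal.ofReal C *
          ∑ _i ∈ Tᶜ, ENNReal.ofReal (300030 * (s * Real.log (n / s)) / n) := by
        gcongr with i hi i hi
        · rw [lintegral_dataLaw_eval θ i
            (f := fun x => ENNReal.ofReal (4 * (x - θ i) ^ 2)) (by fun_prop)]
          exact lintegral_sq_sub_gaussianReal _
        · exact hnoise i hi
    _ = ENNReal.ofReal ((4800 + 16 * A + C) * (s * Real.log (n / s)) + T.card * 4 +
          C * (Tᶜ.card * (300030 * (s * Real.log (n / s)) / n))) := by
        rw [Finset.sum_const, Finset.sum_const, nsmul_eq_mul, nsmul_eq_mul,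
          ← ENNReal.ofReal_natCast, ← ENNReal.ofReal_natCast, ← ENNReal.ofReal_mul (by positivity),
          ← ENNReal.ofReal_mul (by positivity), ← ENNReal.ofReal_mul (by positivity),
          ← ENNReal.ofReal_add (by positivity) (by positivity),
          ← ENNReal.ofReal_add (by positivity) (by positivity)]
    _ ≤ _ := by
        apply ENNReal.ofReal_le_ofReal
        have hc : (Tᶜ.card : ℝ) ≤ n := by
          exact_mod_cast (Finset.card_le_univ _).trans_eq (Fintype.card_fin n)
        have h1 : (Tᶜ.card : ℝ) * (300030 * (s * Real.log (n / s)) / n) ≤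
            300030 * (s * Real.log (n / s)) := by
          calc _ ≤ (n : ℝ) * (300030 * (s * Real.log (n / s)) / n) := by gcongr
            _ = _ := by field_simp
        have h2 := mul_le_mul_of_nonneg_left h1 (by linarith : 0 ≤ C)
        have h3 : 0 ≤ C * (s * Real.log (n / s)) := by positivity
        rw [rate, mul_assoc 2 s]
        nlinarith

end SpikeSlab

theorem theorem5 (A : ℝ) (hA : 0 < A) :
    ∃ C : ℝ, 0 < C ∧ ∃ c₀ : ℝ, 0 < c₀ ∧ ∃ N₀ : ℕ, 0 < N₀ ∧
      ∀ n : ℕ, N₀ ≤ n → ∀ s : ℝ, 1 ≤ s → s ≤ c₀ * n →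
      ∀ αhat : (Fin n → ℝ) → ℝ, (∀ X, SpikeSlab.IsMMLE X (αhat X)) →
        (⨆ θ₀ ∈ SpikeSlab.sparse n s,
            ∫⁻ X, SpikeSlab.posteriorLoss (SpikeSlab.modify A n (αhat X)) θ₀ X
              ∂(SpikeSlab.dataLaw θ₀))
          ≤ ENNReal.ofReal (C * SpikeSlab.rate n s) := by
  obtain ⟨C, hC, hloss⟩ := SpikeSlab.exists_posteriorLoss_le
  obtain ⟨N, hN, hlarge⟩ := SpikeSlab.exists_largeSample hA
  refine ⟨2500 + 8 * A + 200000 * C, by positivity, 1 / 10 ^ 10, by norm_num, N, hN,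
    fun n hn s hs1 hsn αhat hα => iSup₂_le fun θ hθ => ?_⟩
  exact SpikeSlab.lintegral_posteriorLoss_modify_le hA (hlarge n hn) hC hloss hs1 hsn hθ hα
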